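/- Let $P\subset\mathbb{R}^d$ be compact. Let $\Omega=\bigsqcup_{n\ge 0}\Omega_n$, where $\Omega_n$ is the set of sequences $\eta=(\eta_1,\dots,\eta_n,\phi,\phi,\dots)$ with $\eta_i\in P$ and $\phi\notin P$ is a graveyard state. Equip $\Omega$ with the Borel $\sigma$-algebra of $\mathfrak d(\eta,\sigma)=\sum_{i\ge1}2^{-i}\,\bar{\mathfrak d}(\eta_i,\sigma_i)$, where $\bar{\mathfrak d}(p,q)=|p-q|_2$ for $p,q\in P$, $\bar{\mathfrak d}(p,\phi)=\bar{\mathfrak d}(\phi,p)=\operatorname{diam}(P)$ for $p\in P$, and $\bar{\mathfrak d}(\phi,\phi)=0$ (a metric if $P$ has at least two points, otherwise a pseudometric). For $\eta\in\Omega_n$ and $y\in P$ put $\eta\oplus y=(y,\eta_1,\dots,\eta_n,\phi,\dots)$. Let $B_b(\Omega)$ be the space of bounded Borel functions $\Omega\to\mathbb{R}$ with the supremum norm. Let $(\lambda(\eta,\cdot))_{\eta\in\Omega}$ be a family of Borel probability measures on $P$ such that $\eta\mapsto\lambda(\eta,A)$ is Borel measurable for every Borel set $A\subseteq P$, and set $$LF(\eta)=\int_P\bigl[F(\eta\oplus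 y)-F(\eta)\bigr]\,\lambda(\eta,dy),\qquad F\in B_b(\Omega).$$ Then there exists a unique $\Omega$-valued Markov process $(\eta_t)_{t\ge0}$ with bounded generator $L:B_b(\Omega)\to B_b(\Omega)$. In detail: 1. $L$ is a bounded linear operator on $B_b(\Omega)$. 2. There is exactly one transition function $(p_t)_{t\ge0}$ on $\Omega$ (Markov kernels with $p_0(\eta,\cdot)=\delta_\eta$, the Chapman–Kolmogorov equations, and $(t,\eta)\mapsto p_t(\eta,B)$ measurable for every Borel $B$) with generator $L$, i.e. such that $\lim_{t\downarrow0}\sup_{\eta\in\Omega}\bigl|\tfrac1t\bigl(\int F\,dp_t(\eta,\cdot)-F(\eta)\bigr)-LF(\eta)\bigr|=0$ for all $F\in B_b(\Omega)$. 3. Call a process $(\eta_t)_{t\ge0}$ of $\Omega$-valued random variables on a probability space a Markov process with generator $L$ if, for some transition function $(p_t)$ with generator $L$, $\mathbb{E}[F(\eta_{s+t})\mid\sigma(\eta_r:r\le s)]=\int F\,dp_t(\eta_s,\cdot)$ almost surely for all $s,t\ge0$ and $F\in B_b(\Omega)$. For every Borel probability measure $\nu$ on $\Omega$ there exists a Markov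 process with generator $L$ and initial law $\nu$, and any two such processes (possibly on different probability spaces) have the same law on $\Omega^{[0,\infty)}$ with the product $\sigma$-algebra. -/

import Mathlib

open MeasureTheory ProbabilityTheory Filter Topology
open scoped NNReal

/-! ### Configurations of points of a compact set -/

/-- A configuration `(η₁, …, ηₙ, φ, φ, …)` of finitely many points of the compact set `P ⊆ ℝᵈ`;
the type is the disjoint union over `n ≥ 0` of the sets `Ωₙ` of configurations of `n` points. -/
structure Configuration {d : ℕ} (P : TopologicalSpace.Compacts (EuclideanSpace ℝ (Fin d))) where
  /-- The number of points. -/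
  size : ℕ
  /-- The points, in order. -/
  point : Fin size → P

namespace Configuration

variable {d : ℕ} {P : TopologicalSpace.Compacts (EuclideanSpace ℝ (Fin d))}

/-- The entries of the infinite sequence `(η₁, …, ηₙ, φ, φ, …)`, with positions counted from `0`;
the graveyard state `φ` is `none`. -/
def entry (η : Configuration P) (i : ℕ) : Option P :=
  if h : i < η.size then some (η.point ⟨i, h⟩) else none

/-- The configuration `η ⊕ y = (y, η₁, …, ηₙ, φ, …)`. -/
def add (η : Configuration P) (y : P) : Configuration P where
  size := η.size + 1
  point := Fin.cons y η.point

/-- The distance on `P ∪ {φ}`: Euclidean on `P`, and `φ` is at distance `diam P` from `P`. -/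
noncomputable def entryDist : Option P → Option P → ℝ
  | some p, some q => ‖(p : EuclideanSpace ℝ (Fin d)) - q‖
  | some _, none => Metric.diam (P : Set (EuclideanSpace ℝ (Fin d)))
  | none, some _ => Metric.diam (P : Set (EuclideanSpace ℝ (Fin d)))
  | none, none => 0

theorem entryDist_self (a : Option P) : entryDist a a = 0 := by
  cases a <;> simp [entryDist]

theorem entryDist_comm (a b : Option P) : entryDist a b = entryDist b a := by
  cases a <;> cases b <;> simp [entryDist, norm_sub_rev]

theorem norm_sub_le_diam (p q : P) : ‖(p : EuclideanSpace ℝ (Fin d)) - q‖ ≤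
    Metric.diam (P : Set (EuclideanSpace ℝ (Fin d))) := by
  rw [← dist_eq_norm]
  exact Metric.dist_le_diam_of_mem P.isCompact.isBounded p.2 q.2

theorem entryDist_triangle (a b c : Option P) :
    entryDist a c ≤ entryDist a b + entryDist b c := by
  have h0 : 0 ≤ Metric.diam (P : Set (EuclideanSpace ℝ (Fin d))) := Metric.diam_nonneg
  cases a with
  | none => cases b <;> cases c <;> simp [entryDist, h0]
  | some p =>
    cases b with
    | none =>
      cases c with
      | none => simp [entryDist]
      | some r =>
        have := norm_sub_le_diam p r
        simp only [entryDist]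
        linarith
    | some q =>
      cases c with
      | none => simp [entryDist]
      | some r => simpa only [entryDist] using norm_sub_le_norm_sub_add_norm_sub _ _ _

theorem summable_entryDist (η σ : Configuration P) :
    Summable fun i : ℕ => (1 / 2 : ℝ) ^ (i + 1) * entryDist (η.entry i) (σ.entry i) := by
  refine summable_of_ne_finset_zero (s := Finset.range (max η.size σ.size)) fun i hi => ?_
  have h : ¬ i < η.size ∧ ¬ i < σ.size := by
    simp only [Finset.mem_range, lt_max_iff, not_or] at hi
    exact hi
  simp [entry, h.1, h.2, entryDist]

/-- The distance `𝔡(η, σ) = ∑_{i ≥ 1} 2⁻ⁱ 𝔡'(ηᵢ, σᵢ)`, where `𝔡'` is `entryDist`. It is a metric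
as soon as `P` has two points. -/
noncomputable instance : PseudoMetricSpace (Configuration P) where
  dist η σ := ∑' i : ℕ, (1 / 2 : ℝ) ^ (i + 1) * entryDist (η.entry i) (σ.entry i)
  dist_self η := by simp [entryDist_self]
  dist_comm η σ := by simp only [entryDist_comm]
  dist_triangle η σ τ := by
    rw [← (summable_entryDist η σ).tsum_add (summable_entryDist σ τ)]
    refine (summable_entryDist η τ).tsum_le_tsum (fun i => ?_)
      ((summable_entryDist η σ).add (summable_entryDist σ τ))
    rw [← mul_add]
    exact mul_le_mul_of_nonneg_left (entryDist_triangle _ _ _) (by positivity)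

/-- The Borel σ-algebra of `𝔡`. -/
noncomputable instance : MeasurableSpace (Configuration P) := borel _

instance : BorelSpace (Configuration P) := ⟨rfl⟩

end Configuration

/-- `L F(η) = ∫_P [F(η ⊕ y) - F(η)] λ(η, dy)`. -/
noncomputable def configurationGenerator {d : ℕ}
    {P : TopologicalSpace.Compacts (EuclideanSpace ℝ (Fin d))}
    (lam : Kernel (Configuration P) P) (F : Configuration P → ℝ) (η : Configuration P) : ℝ :=
  ∫ y, (F (η.add y) - F η) ∂(lam η)

/-! ### Markov processes and their generators -/

section Markov

variable {S : Type*} [MeasurableSpace S]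

/-- Membership in the space `B_b(S)` of bounded measurable functions. -/
def IsBoundedMeasurable (F : S → ℝ) : Prop :=
  Measurable F ∧ ∃ M : ℝ, ∀ x, |F x| ≤ M

/-- `A` is a bounded linear operator `B_b(S) → B_b(S)` for the supremum norm. -/
structure IsBoundedOperator (A : (S → ℝ) → S → ℝ) : Prop where
  maps : ∀ F, IsBoundedMeasurable F → IsBoundedMeasurable (A F)
  map_add : ∀ F G, IsBoundedMeasurable F → IsBoundedMeasurable G → A (F + G) = A F + A G
  map_smul : ∀ (c : ℝ) (F), IsBoundedMeasurable F → A (c • F) = c • A F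
  bounded : ∃ C : ℝ, ∀ F, IsBoundedMeasurable F → ∀ M : ℝ, (∀ x, |F x| ≤ M) →
    ∀ x, |A F x| ≤ C * M

/-- A time-homogeneous transition function on `S`: `p t x` is the law at time `t` of the process
started at `x`. -/
structure IsTransitionFunction (p : ℝ≥0 → Kernel S S) : Prop where
  markov : ∀ t, IsMarkovKernel (p t)
  zero : p 0 = Kernel.id
  chapman_kolmogorov : ∀ s t, p (s + t) = p t ∘ₖ p s
  measurable : ∀ B, MeasurableSet B → Measurable fun z : ℝ≥0 × S => p z.1 z.2 B

/-- The semigroup `T_t F(x) = ∫ F(y) p(t, x, dy)` on `B_b(S)` has the everywhere defined generator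
`A`: for all `F` in `B_b(S)`, `(T_t F - F) / t → A F` in the supremum norm as `t ↓ 0`. -/
def HasGenerator (p : ℝ≥0 → Kernel S S) (A : (S → ℝ) → S → ℝ) : Prop :=
  ∀ F, IsBoundedMeasurable F →
    TendstoUniformly (fun (t : ℝ≥0) (x : S) => (∫ y, F y ∂(p t x) - F x) / (t : ℝ)) (A F) (𝓝[>] 0)

/-- `X` is a Markov process under `μ` with transition function `p`, with respect to its natural
filtration: `E[F(X_{s+t}) | σ(X_r : r ≤ s)] = ∫ F(y) p(t, X_s, dy)` almost surely. -/
structure IsMarkovProcess {W : Type*} [MeasurableSpace W] (X : ℝ≥0 → W → S) (μ : Measure W)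
    (p : ℝ≥0 → Kernel S S) : Prop where
  measurable : ∀ t, Measurable (X t)
  markov : ∀ (s t : ℝ≥0) (F : S → ℝ), IsBoundedMeasurable F →
    μ[fun ω => F (X (s + t) ω) | ⨆ r ≤ s, MeasurableSpace.comap (X r) inferInstance]
      =ᵐ[μ] fun ω => ∫ y, F y ∂(p t (X s ω))

/-- `X` is a time-homogeneous Markov process under `μ` with generator `A`. -/
def IsMarkovProcessWithGenerator {W : Type*} [MeasurableSpace W] (X : ℝ≥0 → W → S)
    (μ : Measure W) (A : (S → ℝ) → S → ℝ) : Prop :=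
  ∃ p : ℝ≥0 → Kernel S S, IsTransitionFunction p ∧ HasGenerator p A ∧ IsMarkovProcess X μ p

end Markov

/-! Let `K` be the Markov kernel that sends η to the law of η ⊕ y with y drawn from λ(η, ·). On
bounded measurable functions L = K - 1, so L is bounded with norm at most 2, and apart from the
measurability of ⊕ nothing below depends on configurations: the argument treats any Markov kernel on
any measurable space.

The semigroup must be e^{t(K - 1)} = ∑ₙ e⁻ᵗ tⁿ / n! Kⁿ, a Poisson mixture of the powers of `K`. The
semigroup law is the convolution rule for Poisson laws, and isolating the terms n = 0, 1 gives T_t F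
= F + t(KF - F) + O(t²) uniformly (`abs_jumpTransition_sub_le`). If T and S are two semigroups with
the same bounded generator, s ↦ T_{t-s} S_s F is continuous with zero right derivative, hence
constant, and comparing its endpoints gives T_t = S_t (`HasGenerator.transitionFunction_unique`).

The process is Y(N_t), where Y is a chain with kernel `K` and N is an independent rate one Poisson
process; this requires no regularity of the state space. N counts points placed independently in the
unit intervals, a Poisson(1) number of uniform points in each. The exponential formula
`integral_exp_poissonSum` gives both the law of its increments and their independence from the past.
The Markov property follows from those of N and Y by two applications of Fubini
(`setIntegral_jumpProcess`). Finally, the transition function and the initial law determine the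
finite-dimensional laws, hence the law on the product space (`IsMarkovProcess.map_eq`). -/

/-! ### Markov kernels acting on bounded measurable functions -/

section MarkovOperator

variable {S : Type*} [MeasurableSpace S]

/-- The action `F ↦ (x ↦ ∫ F dκ(x))` of a kernel on functions. -/
noncomputable def markovOp {T : Type*} [MeasurableSpace T] (κ : Kernel T S) (F : S → ℝ) (x : T) :
    ℝ :=
  ∫ y, F y ∂(κ x)

variable {T : Type*} [MeasurableSpace T]

theorem IsBoundedMeasurable.integrable {F : S → ℝ} (hF : IsBoundedMeasurable F) (μ : Measure S)
    [IsFiniteMeasure μ] : Integrable F μ := by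
  obtain ⟨hm, M, hM⟩ := hF
  exact .of_bound hm.aestronglyMeasurable M (.of_forall hM)

theorem IsBoundedMeasurable.add {F G : S → ℝ} (hF : IsBoundedMeasurable F)
    (hG : IsBoundedMeasurable G) : IsBoundedMeasurable fun x => F x + G x := by
  obtain ⟨hF, M, hM⟩ := hF
  obtain ⟨hG, N, hN⟩ := hG
  exact ⟨hF.add hG, M + N, fun x => (abs_add_le _ _).trans (add_le_add (hM x) (hN x))⟩

theorem IsBoundedMeasurable.sub {F G : S → ℝ} (hF : IsBoundedMeasurable F)
    (hG : IsBoundedMeasurable G) : IsBoundedMeasurable fun x => F x - G x := by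
  obtain ⟨hF, M, hM⟩ := hF
  obtain ⟨hG, N, hN⟩ := hG
  exact ⟨hF.sub hG, M + N, fun x => (abs_sub _ _).trans (add_le_add (hM x) (hN x))⟩

theorem IsBoundedMeasurable.mul {F G : S → ℝ} (hF : IsBoundedMeasurable F)
    (hG : IsBoundedMeasurable G) : IsBoundedMeasurable fun x => F x * G x := by
  obtain ⟨hF, M, hM⟩ := hF
  obtain ⟨hG, N, hN⟩ := hG
  refine ⟨hF.mul hG, M * N, fun x => ?_⟩
  rw [abs_mul]
  exact mul_le_mul (hM x) (hN x) (abs_nonneg _) ((abs_nonneg _).trans (hM x))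

theorem IsBoundedMeasurable.comp {F : S → ℝ} (hF : IsBoundedMeasurable F) {f : T → S}
    (hf : Measurable f) : IsBoundedMeasurable fun x => F (f x) :=
  ⟨hF.1.comp hf, hF.2.imp fun _ h x => h (f x)⟩

theorem isBoundedMeasurable_indicator {B : Set S} (hB : MeasurableSet B) :
    IsBoundedMeasurable (B.indicator fun _ => (1 : ℝ)) :=
  ⟨measurable_const.indicator hB, 1, fun x => by
    by_cases h : x ∈ B <;> simp [h]⟩

variable (κ : Kernel T S) [IsMarkovKernel κ]

theorem abs_markovOp_le {F : S → ℝ} {M : ℝ} (hM : ∀ x, |F x| ≤ M) (x : T) :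
    |markovOp κ F x| ≤ M := by
  simpa [markovOp] using norm_integral_le_of_norm_le_const (μ := κ x) (f := F) (C := M)
    (.of_forall hM)

theorem IsBoundedMeasurable.markovOp {F : S → ℝ} (hF : IsBoundedMeasurable F) :
    IsBoundedMeasurable (markovOp κ F) := by
  obtain ⟨hm, M, hM⟩ := hF
  exact ⟨hm.stronglyMeasurable.integral_kernel.measurable, M, abs_markovOp_le κ hM⟩

theorem markovOp_sub {F G : S → ℝ} (hF : IsBoundedMeasurable F) (hG : IsBoundedMeasurable G) :
    markovOp κ (fun x => F x - G x) = fun x => markovOp κ F x - markovOp κ G x :=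
  funext fun _ => integral_sub (hF.integrable _) (hG.integrable _)

theorem markovOp_comp {U : Type*} [MeasurableSpace U] (η : Kernel U T) [IsMarkovKernel η]
    {F : S → ℝ} (hF : IsBoundedMeasurable F) :
    markovOp (κ ∘ₖ η) F = markovOp η (markovOp κ F) :=
  funext fun _ => Kernel.integral_comp (hF.integrable _)

theorem kernel_ext_of_markovOp {η : Kernel T S} [IsMarkovKernel η]
    (h : ∀ F : S → ℝ, IsBoundedMeasurable F → markovOp κ F = markovOp η F) : κ = η := by
  ext x B hB
  have := congrFun (h _ (isBoundedMeasurable_indicator hB)) x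
  change ∫ y, B.indicator 1 y ∂(κ x) = ∫ y, B.indicator 1 y ∂(η x) at this
  rw [integral_indicator_one hB, integral_indicator_one hB] at this
  exact (measureReal_eq_measureReal_iff).1 this

end MarkovOperator

/-! ### Uniqueness of the transition function with a given bounded generator -/

section GeneratorUniqueness

variable {S : Type*} [MeasurableSpace S] {p q : ℝ≥0 → Kernel S S} {A : (S → ℝ) → S → ℝ}

theorem IsTransitionFunction.markovOp_add (hp : IsTransitionFunction p) (s t : ℝ≥0) {F : S → ℝ}
    (hF : IsBoundedMeasurable F) :
    markovOp (p (s + t)) F = markovOp (p s) (markovOp (p t) F) := by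
  have := hp.markov
  rw [hp.chapman_kolmogorov, markovOp_comp _ _ hF]

theorem IsTransitionFunction.markovOp_zero (hp : IsTransitionFunction p) {F : S → ℝ}
    (hF : IsBoundedMeasurable F) : markovOp (p 0) F = F := by
  funext x
  simp [markovOp, hp.zero, Kernel.id_apply, integral_dirac' F x hF.1.stronglyMeasurable]

theorem HasGenerator.eventually_abs_sub_sub_le (h : HasGenerator p A) {F : S → ℝ}
    (hF : IsBoundedMeasurable F) {ε : ℝ} (hε : 0 < ε) :
    ∀ᶠ t : ℝ≥0 in 𝓝[>] 0, ∀ x, |markovOp (p t) F x - F x - t * A F x| ≤ ε * t := by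
  filter_upwards [Metric.tendstoUniformly_iff.1 (h F hF) ε hε, self_mem_nhdsWithin] with t ht h0 x
  have h0 : (0 : ℝ) < t := h0
  have := (ht x).le
  rw [Real.dist_eq, abs_sub_comm] at this
  calc _ = |(markovOp (p t) F x - F x) / t - A F x| * t := by
        rw [← abs_of_pos h0, ← abs_mul, abs_of_pos h0]
        congr 1
        field_simp
    _ ≤ ε * t := by gcongr; exact this

/-- Since `A F` is bounded, the first-order expansion forces continuity at time 0 in the supremum
norm. -/
theorem HasGenerator.eventually_abs_sub_le (h : HasGenerator p A) (hA : IsBoundedOperator A)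
    {F : S → ℝ} (hF : IsBoundedMeasurable F) {ε : ℝ} (hε : 0 < ε) :
    ∀ᶠ t : ℝ≥0 in 𝓝[>] 0, ∀ x, |markovOp (p t) F x - F x| ≤ ε := by
  obtain ⟨M, hM⟩ := (hA.maps F hF).2
  have hlim : Tendsto (fun t : ℝ≥0 => (1 + |M|) * (t : ℝ)) (𝓝[>] 0) (𝓝 0) := by
    have : Continuous fun t : ℝ≥0 => (1 + |M|) * (t : ℝ) := by fun_prop
    simpa using (this.tendsto 0).mono_left nhdsWithin_le_nhds
  filter_upwards [h.eventually_abs_sub_sub_le hF one_pos, hlim.eventually_le_const hε]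
    with t ht h1 x
  calc |markovOp (p t) F x - F x|
      = |(markovOp (p t) F x - F x - t * A F x) + t * A F x| := by ring_nf
    _ ≤ 1 * t + t * |M| := by
      refine (abs_add_le _ _).trans (add_le_add (ht x) ?_)
      rw [abs_mul, NNReal.abs_eq]
      exact mul_le_mul_of_nonneg_left ((hM x).trans (le_abs_self M)) t.2
    _ ≤ ε := by linarith

theorem HasGenerator.eventually_abs_markovOp_sub_le (hp : HasGenerator p A) (hq : HasGenerator q A)
    {F : S → ℝ} (hF : IsBoundedMeasurable F) {ε : ℝ} (hε : 0 < ε) :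
    ∀ᶠ t : ℝ≥0 in 𝓝[>] 0, ∀ x, |markovOp (q t) F x - markovOp (p t) F x| ≤ ε * t := by
  filter_upwards [hp.eventually_abs_sub_sub_le hF (half_pos hε),
    hq.eventually_abs_sub_sub_le hF (half_pos hε)] with t h1 h2 x
  have h1 := abs_le.1 (h1 x)
  have h2 := abs_le.1 (h2 x)
  rw [abs_le]
  constructor <;> linarith

/-- Increments of `s ↦ T_{t - s} S_s F` for two semigroups `T` and `S`. -/
theorem IsTransitionFunction.abs_interpolation_sub_le (hp : IsTransitionFunction p)
    (hq : IsTransitionFunction q) {F : S → ℝ} (hF : IsBoundedMeasurable F) {t a h : ℝ≥0}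
    (hab : a + h ≤ t) {C : ℝ}
    (hC : ∀ x, |markovOp (q h) (markovOp (q a) F) x - markovOp (p h) (markovOp (q a) F) x| ≤ C)
    (x : S) :
    |markovOp (p (t - (a + h))) (markovOp (q (a + h)) F) x
      - markovOp (p (t - a)) (markovOp (q a) F) x| ≤ C := by
  have := hp.markov
  have := hq.markov
  have e : t - a = (t - (a + h)) + h := by
    obtain ⟨c, rfl⟩ := exists_add_of_le hab
    rw [add_tsub_cancel_left, add_assoc, add_tsub_cancel_left, add_comm]
  have hG := hF.markovOp (q a)
  rw [e, hp.markovOp_add _ _ hG, add_comm a h, hq.markovOp_add h a hF,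
    ← congrFun (markovOp_sub _ (hG.markovOp (q h)) (hG.markovOp (p h))) x]
  exact abs_markovOp_le _ hC x

theorem exists_pos_of_eventually_nhdsGT_zero {P : ℝ≥0 → Prop} (h : ∀ᶠ t : ℝ≥0 in 𝓝[>] 0, P t) :
    ∃ δ : ℝ, 0 < δ ∧ ∀ t : ℝ≥0, 0 < t → (t : ℝ) < δ → P t := by
  obtain ⟨u, hu, hP⟩ := (mem_nhdsGT_iff_exists_Ioo_subset (a := (0 : ℝ≥0))).1 h
  exact ⟨u, hu, fun t h0 h1 => hP ⟨h0, h1⟩⟩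

/-- The function ψ(s) = T_{t-s} S_s F (x) joins T_t F (x) to S_t F (x). Its increment over [s, s +
h] is T_{t-s-h} applied to (S_h - T_h) S_s F; as T contracts and both semigroups have the same
expansion, this is o(h), so the right derivative vanishes. A vanishing right derivative together
with continuity makes ψ constant. -/
theorem HasGenerator.transitionFunction_unique (hA : IsBoundedOperator A)
    (hp : IsTransitionFunction p) (hq : IsTransitionFunction q)
    (hpA : HasGenerator p A) (hqA : HasGenerator q A) : p = q := by
  have := hp.markov
  have := hq.markov
  funext t
  refine kernel_ext_of_markovOp _ fun F hF => funext fun x => ?_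
  set ψ : ℝ → ℝ := fun s => markovOp (p (t - s.toNNReal)) (markovOp (q s.toNNReal) F) x with hψ
  suffices h : ψ t = ψ 0 by
    simpa [hψ, hp.markovOp_zero (hF.markovOp (q t)), hq.markovOp_zero hF] using h.symm
  have hincr : ∀ s h : ℝ, 0 ≤ s → 0 ≤ h → s + h ≤ t → ∀ C : ℝ,
      (∀ x, |markovOp (q h.toNNReal) (markovOp (q s.toNNReal) F) x
        - markovOp (p h.toNNReal) (markovOp (q s.toNNReal) F) x| ≤ C) → |ψ (s + h) - ψ s| ≤ C := by
    intro s h hs hh hst C hC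
    simp only [hψ]
    rw [Real.toNNReal_add hs hh]
    refine hp.abs_interpolation_sub_le hq hF ?_ hC x
    rw [← Real.toNNReal_add hs hh]
    exact Real.toNNReal_le_iff_le_coe.2 hst
  have hright : ∀ s ∈ Set.Ico (0 : ℝ) t, HasDerivWithinAt ψ 0 (Set.Ici s) s := by
    intro s hs
    rw [hasDerivWithinAt_iff_isLittleO, Asymptotics.isLittleO_iff]
    intro ε hε
    obtain ⟨δ, hδ, h⟩ := exists_pos_of_eventually_nhdsGT_zero
      (hpA.eventually_abs_markovOp_sub_le hqA (hF.markovOp (q s.toNNReal)) hε)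
    filter_upwards [self_mem_nhdsWithin,
      mem_nhdsWithin_of_mem_nhds (Iio_mem_nhds (lt_add_of_pos_right s hδ)),
      mem_nhdsWithin_of_mem_nhds (Iio_mem_nhds hs.2)] with b hb1 hb2 hb3
    rcases eq_or_lt_of_le (show s ≤ b from hb1) with rfl | hlt
    · simp
    have h0 : 0 < b - s := sub_pos.2 hlt
    have hb2 : b < s + δ := hb2
    have hb3 : b < t := hb3
    have key := hincr s (b - s) hs.1 h0.le (by linarith) (ε * (b - s)) (by
      have := h (b - s).toNNReal (Real.toNNReal_pos.2 h0)
        (by rw [Real.coe_toNNReal _ h0.le]; linarith)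
      simpa only [Real.coe_toNNReal _ h0.le] using this)
    rw [add_sub_cancel] at key
    simpa [abs_of_pos h0] using key
  -- The o(h) bound is not uniform in the function it is applied to, so approaching b from the left
  -- it is used for the fixed function S_b F, and S_a F is then replaced by S_b F using norm
  -- continuity of S.
  have hleft : ∀ b ∈ Set.Ioc (0 : ℝ) t, ContinuousWithinAt ψ (Set.Icc 0 b) b := by
    intro b hb
    rw [Metric.continuousWithinAt_iff]
    intro ε hε
    obtain ⟨δ₁, hδ₁, h₁⟩ := exists_pos_of_eventually_nhdsGT_zero
      (hpA.eventually_abs_markovOp_sub_le hqA (hF.markovOp (q b.toNNReal)) (half_pos hε))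
    obtain ⟨δ₂, hδ₂, h₂⟩ := exists_pos_of_eventually_nhdsGT_zero
      (hqA.eventually_abs_sub_le hA hF (show 0 < ε / 8 by positivity))
    refine ⟨min (min δ₁ δ₂) 1, by positivity, fun {a} ha hab => ?_⟩
    rcases eq_or_lt_of_le ha.2 with rfl | hlt
    · simpa
    have h0 : 0 < b - a := sub_pos.2 hlt
    rw [dist_comm, Real.dist_eq, abs_of_pos h0] at hab
    have hδ := lt_min_iff.1 (lt_min_iff.1 hab).1
    set h := (b - a).toNNReal with hh
    have hpos : 0 < h := Real.toNNReal_pos.2 h0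
    have hcoe : (h : ℝ) = b - a := Real.coe_toNNReal _ h0.le
    have hba : b.toNNReal = a.toNNReal + h := by
      rw [hh, ← Real.toNNReal_add ha.1 h0.le, add_sub_cancel]
    have hFa := hF.markovOp (q a.toNNReal)
    have hFb := hF.markovOp (q b.toNNReal)
    have hsub : ∀ y, |markovOp (q a.toNNReal) F y - markovOp (q b.toNNReal) F y| ≤ ε / 8 := by
      intro y
      rw [hba, hq.markovOp_add _ _ hF, abs_sub_comm,
        ← congrFun (markovOp_sub _ (hF.markovOp (q h)) hF) y]
      exact abs_markovOp_le _ (h₂ h hpos (hcoe ▸ hδ.2)) y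
    -- 3ε/4 = ε/2 + ε/8 + ε/8: the o(h) term for S_b F, at most ε/2 because h < 1, and the
    -- replacement error once under each semigroup.
    have key := hincr a (b - a) ha.1 h0.le (by linarith [hb.2]) (3 * ε / 4) (by
      intro y
      have e1 := abs_le.1 (h₁ h hpos (hcoe ▸ hδ.1) y)
      have e2 := abs_markovOp_le (q h) hsub y
      have e3 := abs_markovOp_le (p h) hsub y
      rw [markovOp_sub _ hFa hFb] at e2 e3
      have e2 := abs_le.1 e2
      have e3 := abs_le.1 e3
      have e4 : ε / 2 * h ≤ ε / 2 := by
        rw [hcoe]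
        nlinarith [(lt_min_iff.1 hab).2]
      rw [← hh, abs_le]
      constructor <;> linarith [e1.1, e1.2, e2.1, e2.2, e3.1, e3.2])
    rw [add_sub_cancel] at key
    rw [dist_comm, Real.dist_eq]
    linarith
  have hcont : ContinuousOn ψ (Set.Icc 0 t) := by
    intro s hs
    have hr : ContinuousWithinAt ψ (Set.Icc s t) s := by
      rcases eq_or_lt_of_le hs.2 with rfl | hlt
      · simp [continuousWithinAt_singleton]
      · exact (hright s ⟨hs.1, hlt⟩).continuousWithinAt.mono Set.Icc_subset_Ici_self
    have hl : ContinuousWithinAt ψ (Set.Icc 0 s) s := by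
      rcases eq_or_lt_of_le hs.1 with rfl | hlt
      · simp [continuousWithinAt_singleton]
      · exact hleft s ⟨hlt, hs.2⟩
    rw [← Set.Icc_union_Icc_eq_Icc hs.1 hs.2]
    exact hl.union hr
  exact constant_of_has_deriv_right_zero hcont hright t (Set.right_mem_Icc.2 t.2)

end GeneratorUniqueness

/-! ### The transition function of a chain run at the jumps of a Poisson process -/

section Poissonization

variable {S : Type*} [MeasurableSpace S]

instance Kernel.isMarkovKernel_pow (K : Kernel S S) [IsMarkovKernel K] (n : ℕ) :
    IsMarkovKernel (K ^ n) := by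
  induction n with
  | zero => exact inferInstanceAs (IsMarkovKernel Kernel.id)
  | succ n ih => exact inferInstanceAs (IsMarkovKernel ((K ^ n) ∘ₖ K))

/-- `(t, x) ↦ ∑ₙ e⁻ᵗ tⁿ / n! Kⁿ(x, ·)`. -/
noncomputable def poissonMixture (K : Kernel S S) : Kernel (ℝ≥0 × S) S where
  toFun z := (poissonMeasure z.1).bind fun n => (K ^ n) z.2
  measurable' := by
    refine Measure.measurable_of_measurable_coe _ fun B hB => ?_
    have : (fun z : ℝ≥0 × S => (poissonMeasure z.1).bind (fun n => (K ^ n) z.2) B) =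
        fun z => ∑' n : ℕ, (K ^ n) z.2 B * poissonMeasure z.1 {n} := by
      funext z
      rw [Measure.bind_apply hB (measurable_of_countable _).aemeasurable, lintegral_countable']
    rw [this]
    refine Measurable.tsum fun n => ?_
    refine (((K ^ n).measurable_coe hB).comp measurable_snd).mul ?_
    simp_rw [poissonMeasure_singleton]
    fun_prop

/-- The transition function `e^{t (K - 1)} = ∑ₙ e⁻ᵗ tⁿ / n! Kⁿ`. -/
noncomputable def jumpTransition (K : Kernel S S) (t : ℝ≥0) : Kernel S S :=
  (poissonMixture K).comap (Prod.mk t) measurable_prodMk_left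

theorem jumpTransition_apply (K : Kernel S S) (t : ℝ≥0) (x : S) {B : Set S}
    (hB : MeasurableSet B) :
    jumpTransition K t x B = ∫⁻ n, (K ^ n) x B ∂(poissonMeasure t) :=
  Measure.bind_apply hB (measurable_of_countable _).aemeasurable

theorem markovOp_pow_zero (K : Kernel S S) {F : S → ℝ} (hF : IsBoundedMeasurable F) :
    markovOp (K ^ 0) F = F := by
  funext x
  change ∫ y, F y ∂(Kernel.id x) = F x
  rw [Kernel.id_apply, integral_dirac' F x hF.1.stronglyMeasurable]

variable (K : Kernel S S) [IsMarkovKernel K]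

instance (t : ℝ≥0) : IsMarkovKernel (jumpTransition K t) :=
  ⟨fun x => ⟨by simp [jumpTransition_apply K t x .univ]⟩⟩

theorem markovOp_jumpTransition (t : ℝ≥0) {F : S → ℝ} (hF : IsBoundedMeasurable F) (x : S) :
    markovOp (jumpTransition K t) F x = ∫ n, markovOp (K ^ n) F x ∂(poissonMeasure t) := by
  let κ : Kernel ℕ S := ⟨fun n => (K ^ n) x, measurable_of_countable _⟩
  have h : jumpTransition K t x = (κ ∘ₖ Kernel.const Unit (poissonMeasure t)) () := by
    rw [Kernel.comp_apply, Kernel.const_apply]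
    rfl
  rw [markovOp, h, Kernel.integral_comp (h ▸ hF.integrable (jumpTransition K t x)),
    Kernel.const_apply]
  rfl

theorem markovOp_pow_succ {F : S → ℝ} (hF : IsBoundedMeasurable F) (n : ℕ) :
    markovOp (K ^ (n + 1)) F = markovOp (K ^ n) (markovOp K F) := by
  rw [pow_succ']
  exact markovOp_comp K (K ^ n) hF

theorem isTransitionFunction_jumpTransition : IsTransitionFunction (jumpTransition K) where
  markov t := inferInstance
  zero := by
    ext x B hB
    rw [jumpTransition_apply K 0 x hB, lintegral_countable', tsum_eq_single 0]
    · simp [poissonMeasure_singleton]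
      rfl
    · intro n hn
      simp [poissonMeasure_singleton, hn]
  -- Poisson(s + t) is the convolution of Poisson(s) and Poisson(t), so its mixture of powers is the
  -- double mixture of K^(m + n), which is the composition.
  chapman_kolmogorov s t := by
    ext x B hB
    rw [jumpTransition_apply K _ x hB, Kernel.comp_apply' _ _ _ hB,
      ← poissonMeasure_conv_poissonMeasure, Measure.lintegral_conv (measurable_of_countable _)]
    have hm : Measurable fun y => jumpTransition K t y B := (jumpTransition K t).measurable_coe hB
    let κ : Kernel ℕ S := ⟨fun n => (K ^ n) x, measurable_of_countable _⟩
    have h : jumpTransition K s x = κ ∘ₘ poissonMeasure s := rfl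
    rw [h, Measure.lintegral_bind κ.aemeasurable hm.aemeasurable]
    refine lintegral_congr fun m => ?_
    simp_rw [jumpTransition_apply K t _ hB]
    rw [lintegral_countable']
    simp_rw [lintegral_countable' (μ := poissonMeasure t)]
    rw [lintegral_tsum fun n =>
      (((K ^ n).measurable_coe hB).mul_const _).aemeasurable]
    refine tsum_congr fun n => ?_
    rw [lintegral_mul_const _ ((K ^ n).measurable_coe hB),
      Kernel.pow_add_apply_eq_lintegral _ _ _ _ hB]
    rfl
  -- Joint measurability is built in: the mixture is a kernel in the pair of time and state.
  measurable B hB := (poissonMixture K).measurable_coe hB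

theorem abs_jumpTransition_sub_le {F : S → ℝ} (hF : IsBoundedMeasurable F) {M : ℝ}
    (hM : ∀ x, |F x| ≤ M) (t : ℝ≥0) (ht : t ≤ 1) (x : S) :
    |markovOp (jumpTransition K t) F x - F x - t * (markovOp K F x - F x)| ≤ 3 * M * t ^ 2 := by
  have h0 : (0 : ℝ) ≤ t := t.2
  have hM0 : 0 ≤ M := (abs_nonneg _).trans (hM x)
  set a : ℕ → ℝ := fun n => markovOp (K ^ n) F x with ha
  have haM : ∀ n, |a n| ≤ M := fun n => abs_markovOp_le (K ^ n) hM x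
  have ha0 : a 0 = F x := congrFun (markovOp_pow_zero K hF) x
  have ha1 : a 1 = markovOp K F x := by simp [ha]
  have hsum : HasSum (fun n : ℕ => (Real.exp (-t) * t ^ n / n.factorial) • a n)
      (markovOp (jumpTransition K t) F x) := by
    rw [markovOp_jumpTransition K t hF]
    exact hasSum_integral_poissonMeasure
      (.of_bound (measurable_of_countable _).aestronglyMeasurable M (.of_forall haM))
  -- From n = 2 on, n! ≤ (n + 2)! bounds the series by M t² times the total Poisson mass. Replacing
  -- e⁻ᵗ by 1 - t in the term n = 0, and by 1 in the term n = 1, costs a further M t² each.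
  rw [← hasSum_nat_add_iff' 2] at hsum
  have hexp := (hasSum_one_poissonMeasure t).mul_left (M * (t : ℝ) ^ 2)
  have htail := hsum.norm_le_of_bounded hexp fun n => by
    rw [norm_smul, Real.norm_of_nonneg (by positivity), Real.norm_eq_abs]
    calc Real.exp (-t) * t ^ (n + 2) / (n + 2).factorial * |a (n + 2)|
        ≤ Real.exp (-t) * t ^ (n + 2) / n.factorial * M := by
          gcongr
          · omega
          · exact haM _
      _ = M * t ^ 2 * (Real.exp (-t) * t ^ n / n.factorial) := by ring
  rw [Real.norm_eq_abs] at htail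
  simp only [Finset.sum_range_succ, Finset.sum_range_zero, pow_zero, pow_one, Nat.factorial_zero,
    Nat.factorial_one, Nat.cast_one, div_one, mul_one, zero_add, smul_eq_mul, ha0, ha1] at htail
  have e1 : |Real.exp (-t) - 1 + t| ≤ (t : ℝ) ^ 2 := by
    have := Real.abs_exp_sub_one_sub_id_le (x := -(t : ℝ)) (by simpa [abs_of_nonneg h0] using ht)
    simpa [sub_neg_eq_add] using this
  have e2 : |(t : ℝ) * (Real.exp (-t) - 1)| ≤ (t : ℝ) ^ 2 := by
    have h1 : Real.exp (-t) ≤ 1 := Real.exp_le_one_iff.2 (by linarith)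
    have h2 := Real.add_one_le_exp (-(t : ℝ))
    rw [abs_mul, abs_of_nonneg h0, abs_of_nonpos (by linarith), sq]
    gcongr
    linarith
  have b1 := mul_le_mul e1 (hM x) (abs_nonneg _) (sq_nonneg (t : ℝ))
  have b2 := mul_le_mul e2 (abs_markovOp_le K hM x) (abs_nonneg _) (sq_nonneg (t : ℝ))
  rw [← abs_mul] at b1 b2
  calc _ = |(markovOp (jumpTransition K t) F x
          - (Real.exp (-t) * F x + Real.exp (-t) * t * markovOp K F x))
        + (Real.exp (-t) - 1 + t) * F x + t * (Real.exp (-t) - 1) * markovOp K F x| := by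
        congr 1; ring
    _ ≤ M * t ^ 2 * 1 + t ^ 2 * M + t ^ 2 * M := by
        refine (abs_add_three _ _ _).trans ?_
        gcongr
        simpa using htail
    _ = 3 * M * t ^ 2 := by ring

theorem hasGenerator_jumpTransition :
    HasGenerator (jumpTransition K) fun F x => markovOp K F x - F x := by
  intro F hF
  obtain ⟨M, hM⟩ := hF.2
  rw [Metric.tendstoUniformly_iff]
  intro ε hε
  have hlim : Tendsto (fun t : ℝ≥0 => 3 * M * (t : ℝ)) (𝓝[>] 0) (𝓝 0) := by
    have : Continuous fun t : ℝ≥0 => 3 * M * (t : ℝ) := by fun_prop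
    simpa using (this.tendsto 0).mono_left nhdsWithin_le_nhds
  filter_upwards [hlim.eventually_lt_const hε, self_mem_nhdsWithin,
    mem_nhdsWithin_of_mem_nhds (Iic_mem_nhds (zero_lt_one (α := ℝ≥0)))] with t h1 h0 ht x
  have h0 : (0 : ℝ) < t := h0
  rw [dist_comm, Real.dist_eq]
  have key := abs_jumpTransition_sub_le K hF hM t ht x
  refine lt_of_le_of_lt ?_ h1
  refine le_of_mul_le_mul_right ?_ h0
  rw [← abs_of_pos h0, ← abs_mul, abs_of_pos h0]
  calc _ = |markovOp (jumpTransition K t) F x - F x - t * (markovOp K F x - F x)| := by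
        congr 1
        change ((markovOp (jumpTransition K t) F x - F x) / t - (markovOp K F x - F x)) * t = _
        field_simp
    _ ≤ _ := key.trans_eq (by ring)

theorem isBoundedOperator_markovOp_sub : IsBoundedOperator fun F x => markovOp K F x - F x where
  maps F hF := (hF.markovOp K).sub hF
  map_add F G hF hG := by
    funext x
    simp only [markovOp, Pi.add_apply]
    rw [integral_add (hF.integrable _) (hG.integrable _)]
    ring
  map_smul c F hF := by
    funext x
    simp only [markovOp, Pi.smul_apply, smul_eq_mul]
    rw [integral_const_mul]
    ring
  bounded := ⟨2, fun F hF M hM x => by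
    refine (abs_sub _ _).trans ?_
    linarith [abs_markovOp_le K hM x, hM x]⟩

end Poissonization

/-! ### The Poisson process -/

section PoissonProcess

open Finset (range)

theorem integral_prod_infinitePi {ι : Type*} {X : ι → Type*} [∀ i, MeasurableSpace (X i)]
    (μ : ∀ i, Measure (X i)) [∀ i, IsProbabilityMeasure (μ i)] (s : Finset ι)
    {f : ∀ i, X i → ℂ} (hf : ∀ i, Measurable (f i)) :
    ∫ ω, ∏ i ∈ s, f i (ω i) ∂(Measure.infinitePi μ) = ∏ i ∈ s, ∫ x, f i x ∂(μ i) := by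
  have hm : Measurable fun y : ∀ i : s, X i => ∏ i : s, f i (y i) :=
    Finset.measurable_fun_prod Finset.univ fun i _ => (hf i).comp (measurable_pi_apply i)
  have h := integral_restrict_infinitePi (μ := μ) hm.aestronglyMeasurable
  rw [integral_fintype_prod_eq_prod] at h
  rw [← Finset.prod_coe_sort, ← h]
  refine integral_congr_ae (.of_forall fun ω => ?_)
  exact (Finset.prod_coe_sort s fun i => f i (ω i)).symm

theorem measurable_sum_range_fst {E : Type*} [AddCommMonoid E] [MeasurableSpace E]
    [MeasurableAdd₂ E] {f : ℝ → E} (hf : Measurable f) :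
    Measurable fun b : ℕ × (ℕ → ℝ) => ∑ j ∈ range b.1, f (b.2 j) :=
  measurable_from_prod_countable_right fun n =>
    show Measurable fun U : ℕ → ℝ => ∑ j ∈ range n, f (U j) from
      Finset.measurable_fun_sum _ fun j _ => hf.comp (measurable_pi_apply j)

theorem measurable_cexp_ofReal_mul_I : Measurable fun x : ℝ => Complex.exp (x * Complex.I) := by
  fun_prop

/-- The characteristic functional of a Poisson number of independent points of law `ρ`. -/
theorem integral_exp_sum_poisson_prod_infinitePi (ρ : Measure ℝ) [IsProbabilityMeasure ρ]
    {h : ℝ → ℝ} (hh : Measurable h) :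
    ∫ b : ℕ × (ℕ → ℝ), Complex.exp ((∑ j ∈ range b.1, h (b.2 j) : ℝ) * Complex.I)
      ∂((poissonMeasure 1).prod (Measure.infinitePi fun _ => ρ)) =
    Complex.exp (∫ u, (Complex.exp (h u * Complex.I) - 1) ∂ρ) := by
  have hint : Integrable (fun u => Complex.exp (h u * Complex.I)) ρ :=
    .of_bound (by fun_prop) 1 (.of_forall fun u => (Complex.norm_exp_ofReal_mul_I _).le)
  rw [integral_prod]
  · have : ∀ n : ℕ, ∫ U : ℕ → ℝ, Complex.exp ((∑ j ∈ range n, h (U j) : ℝ) * Complex.I)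
        ∂(Measure.infinitePi fun _ => ρ) = (∫ u, Complex.exp (h u * Complex.I) ∂ρ) ^ n := by
      intro n
      simp_rw [Complex.ofReal_sum, Finset.sum_mul, Complex.exp_sum]
      rw [integral_prod_infinitePi (fun _ => ρ) (range n)
        (f := fun _ u => Complex.exp (h u * Complex.I)) fun _ => by fun_prop]
      simp
    simp_rw [this]
    rw [integral_poissonMeasure, integral_sub hint (integrable_const _), Complex.exp_sub]
    set z := ∫ u, Complex.exp (h u * Complex.I) ∂ρ
    have hz := (NormedSpace.expSeries_div_hasSum_exp z).mul_left (Complex.exp (-1))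
    rw [← Complex.exp_eq_exp_ℂ] at hz
    convert hz.tsum_eq using 1
    · refine tsum_congr fun n => ?_
      simp only [NNReal.coe_one, one_pow, mul_one, Complex.real_smul, Complex.ofReal_div,
        Complex.ofReal_exp, Complex.ofReal_neg, Complex.ofReal_one, Complex.ofReal_natCast]
      ring
    · simp [Complex.exp_neg]
      ring
  · exact .of_bound (measurable_cexp_ofReal_mul_I.comp
      (measurable_sum_range_fst hh)).aestronglyMeasurable 1
      (.of_forall fun b => (Complex.norm_exp_ofReal_mul_I _).le)

/-- The uniform law on the `k`-th unit interval. -/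
noncomputable def unitIntervalLaw (k : ℕ) : Measure ℝ :=
  volume.restrict (Set.Ioc (k : ℝ) (k + 1))

instance (k : ℕ) : IsProbabilityMeasure (unitIntervalLaw k) :=
  ⟨by simp [unitIntervalLaw]⟩

/-- The law of independent families, indexed by `k`, made of a Poisson number and of a sequence of
independent uniform points of the `k`-th unit interval. -/
noncomputable def poissonPointLaw : Measure (ℕ → ℕ × (ℕ → ℝ)) :=
  Measure.infinitePi fun k => (poissonMeasure 1).prod (Measure.infinitePi fun _ => unitIntervalLaw k)

instance : IsProbabilityMeasure poissonPointLaw :=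
  inferInstanceAs (IsProbabilityMeasure (Measure.infinitePi _))

/-- The sum of `h` over the Poisson points of the first `n` unit intervals. -/
def poissonSum (n : ℕ) (h : ℕ → ℝ → ℝ) (ω : ℕ → ℕ × (ℕ → ℝ)) : ℝ :=
  ∑ k ∈ range n, ∑ j ∈ range (ω k).1, h k ((ω k).2 j)

theorem poissonSum_add (n : ℕ) (h g : ℕ → ℝ → ℝ) (ω : ℕ → ℕ × (ℕ → ℝ)) :
    poissonSum n (fun k u => h k u + g k u) ω = poissonSum n h ω + poissonSum n g ω := by
  simp [poissonSum, Finset.sum_add_distrib]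

theorem poissonSum_sub (n : ℕ) (h g : ℕ → ℝ → ℝ) (ω : ℕ → ℕ × (ℕ → ℝ)) :
    poissonSum n (fun k u => h k u - g k u) ω = poissonSum n h ω - poissonSum n g ω := by
  simp [poissonSum, Finset.sum_sub_distrib]

theorem poissonSum_const_mul (n : ℕ) (c : ℝ) (h : ℕ → ℝ → ℝ) (ω : ℕ → ℕ × (ℕ → ℝ)) :
    poissonSum n (fun k u => c * h k u) ω = c * poissonSum n h ω := by
  simp [poissonSum, Finset.mul_sum]

theorem poissonSum_sum {ι : Type*} (s : Finset ι) (n : ℕ) (h : ι → ℕ → ℝ → ℝ)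
    (ω : ℕ → ℕ × (ℕ → ℝ)) :
    poissonSum n (fun k u => ∑ i ∈ s, h i k u) ω = ∑ i ∈ s, poissonSum n (h i) ω := by
  classical
  induction s using Finset.induction_on with
  | empty => simp [poissonSum]
  | insert a s ha ih => simp only [Finset.sum_insert ha, ← ih, ← poissonSum_add]

/-- Distinct unit intervals are independent, so the characteristic functionals of the single
intervals multiply. -/
theorem integral_exp_poissonSum (n : ℕ) {h : ℕ → ℝ → ℝ} (hh : ∀ k, Measurable (h k)) :
    ∫ ω, Complex.exp (poissonSum n h ω * Complex.I) ∂poissonPointLaw =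
      Complex.exp (∑ k ∈ range n,
        ∫ u, (Complex.exp (h k u * Complex.I) - 1) ∂(unitIntervalLaw k)) := by
  simp_rw [poissonSum, Complex.ofReal_sum (range n), Finset.sum_mul, Complex.exp_sum]
  refine (integral_prod_infinitePi (X := fun _ => ℕ × (ℕ → ℝ)) _ (range n) (f := fun k b =>
    Complex.exp ((∑ j ∈ range b.1, h k (b.2 j) : ℝ) * Complex.I)) fun k =>
    measurable_cexp_ofReal_mul_I.comp (measurable_sum_range_fst (hh k))).trans ?_
  exact Finset.prod_congr rfl fun k _ =>
    integral_exp_sum_poisson_prod_infinitePi (unitIntervalLaw k) (hh k)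

/-- Where `h` or `g` vanishes, e^{i(h + g)} - 1 = (e^{ih} - 1) + (e^{ig} - 1), so the exponents add.
This is the source of independent increments. -/
theorem integral_exp_poissonSum_add (n : ℕ) {h g : ℕ → ℝ → ℝ} (hh : ∀ k, Measurable (h k))
    (hg : ∀ k, Measurable (g k)) (hd : ∀ k, ∀ᵐ u ∂(unitIntervalLaw k), h k u = 0 ∨ g k u = 0) :
    ∫ ω, Complex.exp ((poissonSum n h ω + poissonSum n g ω : ℝ) * Complex.I) ∂poissonPointLaw =
      (∫ ω, Complex.exp (poissonSum n h ω * Complex.I) ∂poissonPointLaw) *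
        ∫ ω, Complex.exp (poissonSum n g ω * Complex.I) ∂poissonPointLaw := by
  have hint : ∀ (f : ℕ → ℝ → ℝ) (k : ℕ), Measurable (f k) →
      Integrable (fun u => Complex.exp (f k u * Complex.I) - 1) (unitIntervalLaw k) :=
    fun f k hf => (Integrable.of_bound (by fun_prop) 1
      (.of_forall fun u => (Complex.norm_exp_ofReal_mul_I _).le)).sub (integrable_const _)
  simp_rw [← poissonSum_add]
  rw [integral_exp_poissonSum n
    (show ∀ k, Measurable fun u => h k u + g k u from fun k => (hh k).add (hg k)),
    integral_exp_poissonSum n hh,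
    integral_exp_poissonSum n hg, ← Complex.exp_add, ← Finset.sum_add_distrib]
  congr 1
  refine Finset.sum_congr rfl fun k _ => ?_
  rw [← integral_add (hint h k (hh k)) (hint g k (hg k))]
  refine integral_congr_ae ?_
  filter_upwards [hd k] with u hu
  rcases hu with hu | hu <;> simp [hu]

/-- The indicator function of `[0, t]`, cut off on unit intervals starting at or after `t`. -/
noncomputable def timeIndicator (t : ℝ≥0) (k : ℕ) (u : ℝ) : ℕ :=
  if (k : ℝ) < t ∧ u ≤ t then 1 else 0

theorem measurable_timeIndicator (t : ℝ≥0) (k : ℕ) : Measurable (timeIndicator t k) :=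
  Measurable.ite (((MeasurableSet.const _).inter measurableSet_Iic)) measurable_const
    measurable_const

theorem measurable_timeIndicator_cast (t : ℝ≥0) (k : ℕ) :
    Measurable fun u => (timeIndicator t k u : ℝ) :=
  (measurable_of_countable _).comp (measurable_timeIndicator t k)

theorem timeIndicator_mono {s t : ℝ≥0} (h : s ≤ t) (k : ℕ) (u : ℝ) :
    timeIndicator s k u ≤ timeIndicator t k u := by
  have : (s : ℝ) ≤ t := h
  simp only [timeIndicator]
  split_ifs <;> grind

/-- The Poisson process of rate `1`. -/
noncomputable def poissonProcess (t : ℝ≥0) (ω : ℕ → ℕ × (ℕ → ℝ)) : ℕ :=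
  ∑ k ∈ range ⌈t⌉₊, ∑ j ∈ range (ω k).1, timeIndicator t k ((ω k).2 j)

/-- The cutoff in `timeIndicator` makes the extra terms vanish for every ω. Sample points are
arbitrary reals, lying in their unit intervals only almost surely; without the cutoff this identity,
and the monotonicity deduced from it, would need exceptional null sets. -/
theorem poissonProcess_eq_sum {t : ℝ≥0} {n : ℕ} (h : ⌈t⌉₊ ≤ n) (ω : ℕ → ℕ × (ℕ → ℝ)) :
    poissonProcess t ω =
      ∑ k ∈ range n, ∑ j ∈ range (ω k).1, timeIndicator t k ((ω k).2 j) := by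
  refine Finset.sum_subset (by simpa using h) fun k _ hk => ?_
  have hk : (t : ℝ) ≤ k := by
    have : t ≤ k := Nat.ceil_le.1 (by simpa using hk)
    exact_mod_cast this
  simp [timeIndicator, hk.not_gt]

theorem poissonProcess_eq_poissonSum {t : ℝ≥0} {n : ℕ} (h : ⌈t⌉₊ ≤ n) (ω : ℕ → ℕ × (ℕ → ℝ)) :
    (poissonProcess t ω : ℝ) = poissonSum n (fun k u => timeIndicator t k u) ω := by
  simp [poissonProcess_eq_sum h, poissonSum]

theorem poissonProcess_mono (ω : ℕ → ℕ × (ℕ → ℝ)) : Monotone (poissonProcess · ω) := by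
  intro s t h
  simp only [poissonProcess_eq_sum (Nat.ceil_mono h) ω, poissonProcess_eq_sum le_rfl ω]
  exact Finset.sum_le_sum fun k _ => Finset.sum_le_sum fun j _ => timeIndicator_mono h _ _

theorem poissonProcess_zero (ω : ℕ → ℕ × (ℕ → ℝ)) : poissonProcess 0 ω = 0 := by
  simp [poissonProcess]

theorem measurable_poissonProcess (t : ℝ≥0) : Measurable (poissonProcess t) :=
  Finset.measurable_fun_sum _ fun k _ =>
    (measurable_sum_range_fst (measurable_timeIndicator t k)).comp (measurable_pi_apply k)

theorem timeIndicator_of_mem {t : ℝ≥0} {k : ℕ} {u : ℝ} (hu : u ∈ Set.Ioc (k : ℝ) (k + 1)) :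
    timeIndicator t k u = if u ≤ t then 1 else 0 := by
  simp only [timeIndicator]
  have := hu.1
  split_ifs <;> grind

/-- The increment of the Poisson process. -/
noncomputable def poissonIncrement (s t : ℝ≥0) (ω : ℕ → ℕ × (ℕ → ℝ)) : ℕ :=
  poissonProcess (s + t) ω - poissonProcess s ω

theorem measurable_poissonIncrement (s t : ℝ≥0) : Measurable (poissonIncrement s t) :=
  (measurable_poissonProcess _).sub (measurable_poissonProcess _)

theorem poissonProcess_add (s t : ℝ≥0) (ω : ℕ → ℕ × (ℕ → ℝ)) :
    poissonProcess (s + t) ω = poissonProcess s ω + poissonIncrement s t ω :=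
  (Nat.add_sub_cancel' (poissonProcess_mono ω le_self_add)).symm

theorem mul_poissonIncrement_eq_poissonSum (c : ℝ) {s t : ℝ≥0} {n : ℕ} (h : ⌈s + t⌉₊ ≤ n)
    (ω : ℕ → ℕ × (ℕ → ℝ)) :
    c * (poissonIncrement s t ω : ℝ) =
      poissonSum n (fun k u => c * (timeIndicator (s + t) k u - timeIndicator s k u)) ω := by
  rw [poissonSum_const_mul, poissonSum_sub, ← poissonProcess_eq_poissonSum h,
    ← poissonProcess_eq_poissonSum ((Nat.ceil_mono le_self_add).trans h), poissonProcess_add]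
  simp

/-- By the exponential formula the increment has characteristic exponent t(e^{iθ} - 1), the integral
of e^{iθ} - 1 over (s, s + t]. -/
theorem map_poissonIncrement (s t : ℝ≥0) :
    poissonPointLaw.map (poissonIncrement s t) = poissonMeasure t := by
  apply (MeasurableEmbedding.natCast (α := ℝ)).map_injective
  have hm := measurable_poissonIncrement s t
  apply Measure.ext_of_charFun
  ext θ
  rw [charFun_map_cast_poissonMeasure, charFun_apply_real,
    Measure.map_map (by fun_prop) hm, integral_map (by fun_prop) (by fun_prop)]
  have e : ∀ ω, Complex.exp (θ * ((Nat.cast ∘ poissonIncrement s t) ω : ℝ) * Complex.I) =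
      Complex.exp (poissonSum ⌈s + t⌉₊
        (fun k u => θ * (timeIndicator (s + t) k u - timeIndicator s k u)) ω * Complex.I) := by
    intro ω
    rw [← mul_poissonIncrement_eq_poissonSum θ le_rfl]
    simp
  simp_rw [e]
  have hmeas : ∀ k, Measurable fun u : ℝ =>
      θ * ((timeIndicator (s + t) k u : ℝ) - timeIndicator s k u) := fun k =>
    ((measurable_timeIndicator_cast _ k).sub (measurable_timeIndicator_cast _ k)).const_mul θ
  rw [integral_exp_poissonSum _ hmeas]
  congr 1
  set f : ℝ → ℂ := (Set.Ioc (s : ℝ) (s + t)).indicator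
    fun _ => Complex.exp (θ * Complex.I) - 1 with hf
  have hfi : Integrable f :=
    (integrable_indicator_iff measurableSet_Ioc).2 (integrableOn_const (by simp))
  have : ∀ k : ℕ, ∫ u, (Complex.exp ((θ * (timeIndicator (s + t) k u - timeIndicator s k u) : ℝ)
      * Complex.I) - 1) ∂(unitIntervalLaw k) = ∫ u in (k : ℝ)..((k + 1 : ℕ) : ℝ), f u := by
    intro k
    rw [intervalIntegral.integral_of_le (by simp), Nat.cast_add_one]
    refine setIntegral_congr_fun measurableSet_Ioc fun u hu => ?_
    simp only [timeIndicator_of_mem hu, hf, Set.indicator, Set.mem_Ioc, NNReal.coe_add]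
    have : (0 : ℝ) ≤ t := t.2
    by_cases h1 : u ≤ s
    · simp [h1, h1.not_gt, h1.trans (le_add_of_nonneg_right this)]
    · by_cases h2 : u ≤ s + t <;> simp [h1, h2, not_le.1 h1]
  simp_rw [this]
  -- The unit intervals glue to (0, ⌈s + t⌉], which contains the support (s, s + t] of `f`.
  rw [intervalIntegral.sum_integral_adjacent_intervals
    fun k _ => hfi.intervalIntegrable, intervalIntegral.integral_of_le (by simp),
    setIntegral_indicator measurableSet_Ioc, setIntegral_const]
  have hc : ((s + t : ℝ≥0) : ℝ) ≤ ⌈s + t⌉₊ := by exact_mod_cast Nat.le_ceil (s + t)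
  rw [Set.inter_eq_self_of_subset_right]
  · simp
  · exact Set.Ioc_subset_Ioc (by simp) (by simpa using hc)

/-- For finitely many past times, a linear combination of past values sums a function carried by u ≤
s, while the increment sums one carried by s < u ≤ s + t. The joint characteristic function
therefore factors. -/
theorem indepFun_poissonProcess_poissonIncrement (s t : ℝ≥0) :
    IndepFun (fun ω (r : Set.Iic s) => poissonProcess r ω) (poissonIncrement s t)
      poissonPointLaw := by
  refine IndepFun.process_indepFun (fun r => measurable_poissonProcess r)
    (measurable_poissonIncrement s t) fun I => ?_
  let X : (ℕ → ℕ × (ℕ → ℝ)) → EuclideanSpace ℝ I :=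
    fun ω => WithLp.toLp 2 fun r => (poissonProcess r ω : ℝ)
  let Y : (ℕ → ℕ × (ℕ → ℝ)) → ℝ := fun ω => poissonIncrement s t ω
  have hX : Measurable X := (WithLp.measurable_toLp 2 _).comp <| measurable_pi_lambda _ fun r =>
    (measurable_of_countable Nat.cast).comp (measurable_poissonProcess r)
  have hY : Measurable Y :=
    (measurable_of_countable Nat.cast).comp (measurable_poissonIncrement s t)
  -- Characteristic functions need real-valued variables; the floor recovers the integer ones.
  suffices h : IndepFun X Y poissonPointLaw by
    have hφ : Measurable fun (x : EuclideanSpace ℝ I) (r : I) => ⌊x.ofLp r⌋₊ :=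
      measurable_pi_lambda _ fun r => Nat.measurable_floor.comp
        (show Measurable fun x : EuclideanSpace ℝ I => x.ofLp r by fun_prop)
    have := h.comp hφ (Nat.measurable_floor (R := ℝ))
    simpa [Function.comp_def, X, Y] using this
  rw [indepFun_iff_charFun_prod hX.aemeasurable hY.aemeasurable]
  intro v
  set n := ⌈s + t⌉₊
  set h : ℕ → ℝ → ℝ := fun k u => ∑ r : I, v.fst r * timeIndicator r k u
  set g : ℕ → ℝ → ℝ := fun k u => v.snd * (timeIndicator (s + t) k u - timeIndicator s k u)
  have hh : ∀ k, Measurable (h k) := fun k => Finset.measurable_fun_sum _ fun r _ =>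
    (measurable_timeIndicator_cast _ k).const_mul _
  have hg : ∀ k, Measurable (g k) := fun k => ((measurable_timeIndicator_cast _ k).sub
    (measurable_timeIndicator_cast _ k)).const_mul _
  have eX : ∀ ω, inner ℝ (X ω) v.fst = poissonSum n h ω := by
    intro ω
    simp only [h, X, PiLp.inner_apply]
    rw [poissonSum_sum]
    refine Finset.sum_congr rfl fun r _ => ?_
    rw [poissonSum_const_mul, ← poissonProcess_eq_poissonSum
      (Nat.ceil_mono ((show (r : ℝ≥0) ≤ s from r.1.2).trans le_self_add))]
    simp
  have eY : ∀ ω, inner ℝ (Y ω) v.snd = poissonSum n g ω := by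
    intro ω
    rw [← mul_poissonIncrement_eq_poissonSum _ le_rfl]
    simp [Y]
  rw [charFun_apply, charFun_apply, charFun_apply,
    integral_map (by fun_prop) (by fun_prop), integral_map (by fun_prop) (by fun_prop),
    integral_map (by fun_prop) (by fun_prop)]
  simp only [WithLp.prod_inner_apply]
  change ∫ ω, Complex.exp ((inner ℝ (X ω) v.fst + inner ℝ (Y ω) v.snd : ℝ) * Complex.I)
    ∂poissonPointLaw = (∫ ω, Complex.exp ((inner ℝ (X ω) v.fst : ℝ) * Complex.I)
    ∂poissonPointLaw) * ∫ ω, Complex.exp ((inner ℝ (Y ω) v.snd : ℝ) * Complex.I) ∂poissonPointLaw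
  simp_rw [eX, eY]
  refine integral_exp_poissonSum_add n hh hg fun k => ?_
  filter_upwards [ae_restrict_mem measurableSet_Ioc] with u hu
  simp only [h, g, timeIndicator_of_mem hu, NNReal.coe_add]
  by_cases hs : u ≤ s
  · right
    have : u ≤ (s : ℝ) + t := hs.trans (le_add_of_nonneg_right t.2)
    simp [hs, this]
  · left
    refine Finset.sum_eq_zero fun r _ => ?_
    have : ((r : ℝ≥0) : ℝ) ≤ s := r.1.2
    simp [not_le.2 (this.trans_lt (not_le.1 hs))]

end PoissonProcess

/-! ### The Markov chain and the Markov jump process -/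

section JumpProcess

open Preorder (frestrictLe frestrictLe₂)

variable {S : Type*} [MeasurableSpace S] (K : Kernel S S) [IsMarkovKernel K]
  (ν : Measure S)

/-- The transition of a chain with transition kernel `K`, given its trajectory up to time `n`. -/
noncomputable def chainKernel (n : ℕ) : Kernel (Finset.Iic n → S) S :=
  K.comap (fun y => y ⟨n, Finset.mem_Iic.2 le_rfl⟩) (measurable_pi_apply _)

instance (n : ℕ) : IsMarkovKernel (chainKernel K n) :=
  inferInstanceAs (IsMarkovKernel (K.comap _ _))

/-- The law of the Markov chain with initial law `ν` and transition kernel `K`. -/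
noncomputable def chainLaw : Measure (ℕ → S) :=
  Kernel.trajMeasure (X := fun _ => S) ν (chainKernel K)

theorem map_eval_zero_chainLaw : (chainLaw K ν).map (fun y => y 0) = ν := by
  have h : (chainLaw K ν).map (frestrictLe (π := fun _ => S) 0) =
      ν.map (MeasurableEquiv.piUnique (fun _ : Finset.Iic 0 => S)).symm := by
    rw [chainLaw, Kernel.trajMeasure, Measure.map_comp _ _ (by fun_prop),
      Kernel.traj_map_frestrictLe, Kernel.partialTraj_self, Measure.id_comp]
  have h2 := congrArg (Measure.map fun y : Finset.Iic 0 → S => y ⟨0, by simp⟩) h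
  rw [Measure.map_map (measurable_pi_apply _) (by fun_prop),
    Measure.map_map (measurable_pi_apply _) (by fun_prop)] at h2
  refine h2.trans ?_
  exact Measure.map_id

variable [IsProbabilityMeasure ν]

instance : IsProbabilityMeasure (chainLaw K ν) :=
  inferInstanceAs (IsProbabilityMeasure (Kernel.trajMeasure (X := fun _ => S) ν (chainKernel K)))

theorem integral_chainLaw_succ (n : ℕ) {G : (Finset.Iic n → S) → ℝ} (hG : IsBoundedMeasurable G)
    {F : S → ℝ} (hF : IsBoundedMeasurable F) :
    ∫ y, G (frestrictLe n y) * F (y (n + 1)) ∂(chainLaw K ν) =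
      ∫ y, G (frestrictLe n y) * markovOp K F (y n) ∂(chainLaw K ν) := by
  have h := Kernel.map_frestrictLe_trajMeasure_compProd_eq_map_trajMeasure
    (X := fun _ => S) (κ := chainKernel K) (μ₀ := ν) (a := n)
  have hm : IsBoundedMeasurable fun z : (Finset.Iic n → S) × S => G z.1 * F z.2 :=
    (hG.comp measurable_fst).mul (hF.comp measurable_snd)
  have hr : Measurable (frestrictLe (π := fun _ => S) n) := by fun_prop
  have hpair : Measurable fun y : ℕ → S => (frestrictLe (π := fun _ => S) n y, y (n + 1)) :=
    hr.prodMk (measurable_pi_apply _)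
  have hprob : IsProbabilityMeasure ((chainLaw K ν).map (frestrictLe (π := fun _ => S) n)) :=
    Measure.isProbabilityMeasure_map hr.aemeasurable
  change (chainLaw K ν).map (frestrictLe (π := fun _ => S) n) ⊗ₘ chainKernel K n =
    (chainLaw K ν).map fun y => (frestrictLe (π := fun _ => S) n y, y (n + 1)) at h
  calc _ = ∫ z, G z.1 * F z.2 ∂((chainLaw K ν).map
          fun y => (frestrictLe (π := fun _ => S) n y, y (n + 1))) :=
        (integral_map hpair.aemeasurable hm.1.aestronglyMeasurable).symm
    _ = ∫ x, ∫ z, G x * F z ∂(chainKernel K n x)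
          ∂((chainLaw K ν).map (frestrictLe (π := fun _ => S) n)) := by
        rw [← h, Measure.integral_compProd (hm.integrable _)]
    _ = ∫ x, G x * markovOp K F (x ⟨n, Finset.mem_Iic.2 le_rfl⟩)
          ∂((chainLaw K ν).map (frestrictLe (π := fun _ => S) n)) := by
        simp_rw [integral_const_mul]
        rfl
    _ = _ := integral_map hr.aemeasurable
        (hG.mul ((hF.markovOp K).comp (measurable_pi_apply _))).1.aestronglyMeasurable

theorem integral_chainLaw_add (n m : ℕ) {G : (Finset.Iic n → S) → ℝ} (hG : IsBoundedMeasurable G)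
    {F : S → ℝ} (hF : IsBoundedMeasurable F) :
    ∫ y, G (frestrictLe n y) * F (y (n + m)) ∂(chainLaw K ν) =
      ∫ y, G (frestrictLe n y) * markovOp (K ^ m) F (y n) ∂(chainLaw K ν) := by
  induction m generalizing F with
  | zero => simp only [add_zero, markovOp_pow_zero K hF]
  | succ m ih =>
    -- The last step is peeled off, which requires viewing `G` as a function of the trajectory up to
    -- n + m.
    have hG' : IsBoundedMeasurable fun z : Finset.Iic (n + m) → S =>
        G (frestrictLe₂ (π := fun _ => S) (Nat.le_add_right n m) z) := hG.comp <|
      measurable_pi_lambda _ fun _ => measurable_pi_apply _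
    rw [markovOp_pow_succ K hF, ← ih (hF.markovOp K)]
    exact integral_chainLaw_succ K ν (n + m) hG' hF

/-- The law of a Poisson process together with an independent Markov chain. -/
noncomputable def jumpLaw : Measure ((ℕ → ℕ × (ℕ → ℝ)) × (ℕ → S)) :=
  poissonPointLaw.prod (chainLaw K ν)

instance : IsProbabilityMeasure (jumpLaw K ν) :=
  inferInstanceAs (IsProbabilityMeasure (poissonPointLaw.prod (chainLaw K ν)))

/-- The Markov chain run at the jumps of the Poisson process. -/
noncomputable def jumpProcess (t : ℝ≥0) (ω : (ℕ → ℕ × (ℕ → ℝ)) × (ℕ → S)) : S :=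
  ω.2 (poissonProcess t ω.1)

theorem measurable_apply_nat {W : Type*} [MeasurableSpace W] {N : W → ℕ} (hN : Measurable N)
    {Y : ℕ → W → S} (hY : ∀ n, Measurable (Y n)) : Measurable fun ω => Y (N ω) ω := by
  have : Measurable fun z : ℕ × W => Y z.1 z.2 := measurable_from_prod_countable_right hY
  exact this.comp (hN.prodMk measurable_id)

theorem measurable_jumpProcess (t : ℝ≥0) : Measurable (jumpProcess (S := S) t) :=
  measurable_apply_nat ((measurable_poissonProcess t).comp measurable_fst)
    fun n => (measurable_pi_apply n).comp measurable_snd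

theorem map_jumpProcess_zero : (jumpLaw K ν).map (jumpProcess 0) = ν := by
  have : jumpProcess (S := S) 0 = (fun y : ℕ → S => y 0) ∘ Prod.snd := by
    funext ω
    simp [jumpProcess, poissonProcess_zero]
  rw [this, ← Measure.map_map (measurable_pi_apply 0) measurable_snd, jumpLaw,
    Measure.map_snd_prod, measure_univ, one_smul, map_eval_zero_chainLaw]

/-- The `σ`-algebra of the jump process up to time `s`. -/
noncomputable abbrev jumpPast (S : Type*) [MeasurableSpace S] (s : ℝ≥0) :
    MeasurableSpace ((ℕ → ℕ × (ℕ → ℝ)) × (ℕ → S)) :=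
  ⨆ r ≤ s, MeasurableSpace.comap (jumpProcess (S := S) r) inferInstance

theorem jumpPast_le (s : ℝ≥0) : jumpPast S s ≤ Prod.instMeasurableSpace :=
  iSup₂_le fun r _ => (measurable_jumpProcess r).comap_le

/-- Once the Poisson path is frozen, each X_r with r ≤ s reads the chain at an index at most N_s, so
the past of the process becomes a past event of the chain. -/
theorem exists_section_chain {s : ℝ≥0} {A : Set ((ℕ → ℕ × (ℕ → ℝ)) × (ℕ → S))}
    (hA : MeasurableSet[jumpPast S s] A) (ω : ℕ → ℕ × (ℕ → ℝ)) :
    ∃ B : Set (Finset.Iic (poissonProcess s ω) → S), MeasurableSet B ∧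
      frestrictLe (poissonProcess s ω) ⁻¹' B = Prod.mk ω ⁻¹' A := by
  have h : (jumpPast S s).comap (Prod.mk ω) ≤ MeasurableSpace.comap
      (frestrictLe (π := fun _ => S) (poissonProcess s ω)) inferInstance := by
    simp only [jumpPast, MeasurableSpace.comap_iSup, MeasurableSpace.comap_comp]
    refine iSup₂_le fun r hr => ?_
    rintro _ ⟨C, hC, rfl⟩
    exact ⟨(fun y => y ⟨poissonProcess r ω, Finset.mem_Iic.2 (poissonProcess_mono ω hr)⟩) ⁻¹' C,
      measurable_pi_apply _ hC, rfl⟩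
  exact h _ ⟨A, hA, rfl⟩

/-- With the chain frozen instead, X_r is a function of N_r, so the past of the process becomes a
past event of the Poisson process. -/
theorem exists_section_poisson {s : ℝ≥0} {A : Set ((ℕ → ℕ × (ℕ → ℝ)) × (ℕ → S))}
    (hA : MeasurableSet[jumpPast S s] A) (y : ℕ → S) :
    ∃ B : Set (Set.Iic s → ℕ), MeasurableSet B ∧
      (fun ω (r : Set.Iic s) => poissonProcess r ω) ⁻¹' B = (fun ω => (ω, y)) ⁻¹' A := by
  have h : (jumpPast S s).comap (fun ω => (ω, y)) ≤ MeasurableSpace.comap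
      (fun ω (r : Set.Iic s) => poissonProcess r ω) inferInstance := by
    simp only [jumpPast, MeasurableSpace.comap_iSup, MeasurableSpace.comap_comp]
    refine iSup₂_le fun r hr => ?_
    rintro _ ⟨C, hC, rfl⟩
    exact ⟨(fun v => y (v ⟨r, hr⟩)) ⁻¹' C,
      ((measurable_of_countable y).comp (measurable_pi_apply _)) hC, rfl⟩
  exact h _ ⟨A, hA, rfl⟩

/-- The increment is independent of the past and has law Poisson(t); averaging K^n over it produces
the transition function. -/
theorem integral_poisson_past_mul {s t : ℝ≥0} {B : Set (Set.Iic s → ℕ)} (hB : MeasurableSet B)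
    {F : S → ℝ} (hF : IsBoundedMeasurable F) (y : ℕ → S) :
    ∫ ω, B.indicator (fun _ => (1 : ℝ)) (fun r => poissonProcess r ω) *
        markovOp (K ^ poissonIncrement s t ω) F (y (poissonProcess s ω)) ∂poissonPointLaw =
      ∫ ω, B.indicator (fun _ => (1 : ℝ)) (fun r => poissonProcess r ω) *
        markovOp (jumpTransition K t) F (y (poissonProcess s ω)) ∂poissonPointLaw := by
  have hV : Measurable fun ω (r : Set.Iic s) => poissonProcess r ω :=
    measurable_pi_lambda _ fun r => measurable_poissonProcess r
  have hN := measurable_poissonIncrement s t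
  have hlaw := (indepFun_iff_map_prod_eq_prod_map_map hV.aemeasurable hN.aemeasurable).1
    (indepFun_poissonProcess_poissonIncrement s t)
  rw [map_poissonIncrement] at hlaw
  have hprob : IsProbabilityMeasure
      (poissonPointLaw.map fun ω (r : Set.Iic s) => poissonProcess r ω) :=
    Measure.isProbabilityMeasure_map hV.aemeasurable
  have hs : Measurable fun v : Set.Iic s → ℕ => y (v ⟨s, Set.mem_Iic.2 le_rfl⟩) :=
    (measurable_of_countable y).comp (measurable_pi_apply _)
  obtain ⟨M, hM⟩ := hF.2
  set φ : (Set.Iic s → ℕ) × ℕ → ℝ := fun z => B.indicator (fun _ => (1 : ℝ)) z.1 *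
    markovOp (K ^ z.2) F (y (z.1 ⟨s, Set.mem_Iic.2 le_rfl⟩)) with hφ
  have hφm : IsBoundedMeasurable φ := by
    refine ((isBoundedMeasurable_indicator hB).comp measurable_fst).mul ⟨?_, M, fun z => ?_⟩
    · exact measurable_from_prod_countable_left fun n => (hF.markovOp (K ^ n)).1.comp hs
    · exact abs_markovOp_le (K ^ z.2) hM _
  calc _ = ∫ z, φ z ∂(poissonPointLaw.map
          fun ω => (fun r : Set.Iic s => poissonProcess r ω, poissonIncrement s t ω)) :=
        (integral_map (hV.prodMk hN).aemeasurable hφm.1.aestronglyMeasurable).symm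
    _ = ∫ v, B.indicator (fun _ => (1 : ℝ)) v * markovOp (jumpTransition K t) F
          (y (v ⟨s, Set.mem_Iic.2 le_rfl⟩))
          ∂(poissonPointLaw.map fun ω (r : Set.Iic s) => poissonProcess r ω) := by
        rw [hlaw, integral_prod _ (hφm.integrable _)]
        refine integral_congr_ae (.of_forall fun v => ?_)
        simp only [hφ]
        rw [integral_const_mul, markovOp_jumpTransition K t hF]
    _ = _ := integral_map hV.aemeasurable
        ((isBoundedMeasurable_indicator hB).mul
          ((hF.markovOp (jumpTransition K t)).comp hs)).1.aestronglyMeasurable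

theorem setIntegral_jumpProcess {s t : ℝ≥0} {A : Set ((ℕ → ℕ × (ℕ → ℝ)) × (ℕ → S))}
    (hA : MeasurableSet[jumpPast S s] A) {F : S → ℝ} (hF : IsBoundedMeasurable F) :
    ∫ ω in A, markovOp (jumpTransition K t) F (jumpProcess s ω) ∂(jumpLaw K ν) =
      ∫ ω in A, F (jumpProcess (s + t) ω) ∂(jumpLaw K ν) := by
  have hA' : MeasurableSet A := jumpPast_le s _ hA
  obtain ⟨M, hM⟩ := hF.2
  have h1 := isBoundedMeasurable_indicator hA'
  have hmul : ∀ f : (ℕ → ℕ × (ℕ → ℝ)) × (ℕ → S) → ℝ,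
      ∫ ω in A, f ω ∂(jumpLaw K ν) = ∫ ω, A.indicator (fun _ => (1 : ℝ)) ω * f ω ∂(jumpLaw K ν) := by
    intro f
    rw [← integral_indicator hA']
    congr with ω
    by_cases h : ω ∈ A <;> simp [h]
  have hbmid : IsBoundedMeasurable fun ω : (ℕ → ℕ × (ℕ → ℝ)) × (ℕ → S) =>
      A.indicator (fun _ => (1 : ℝ)) ω * markovOp (K ^ poissonIncrement s t ω.1) F (jumpProcess s ω) :=
    h1.mul ⟨measurable_apply_nat ((measurable_poissonIncrement s t).comp measurable_fst)
      fun n => (hF.markovOp (K ^ n)).1.comp (measurable_jumpProcess s), M,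
      fun ω => abs_markovOp_le (K ^ poissonIncrement s t ω.1) hM _⟩
  have hbl := h1.mul ((hF.markovOp (jumpTransition K t)).comp (measurable_jumpProcess s))
  have hbr := h1.mul (hF.comp (measurable_jumpProcess (s + t)))
  rw [hmul, hmul]
  -- The intermediate integral keeps the random power of `K`. It equals the left side by integrating
  -- over the Poisson process with the chain frozen, and the right side by integrating over the
  -- chain with the Poisson path frozen.
  trans ∫ ω, A.indicator (fun _ => (1 : ℝ)) ω *
    markovOp (K ^ poissonIncrement s t ω.1) F (jumpProcess s ω) ∂(jumpLaw K ν)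
  · rw [jumpLaw, integral_prod_symm _ (hbl.integrable _), integral_prod_symm _ (hbmid.integrable _)]
    refine integral_congr_ae (.of_forall fun y => ?_)
    obtain ⟨B, hB, hBA⟩ := exists_section_poisson hA y
    have e : ∀ ω, A.indicator (fun _ => (1 : ℝ)) (ω, y) =
        B.indicator (fun _ => (1 : ℝ)) (fun r => poissonProcess r ω) := fun ω => by
      have : (fun r : Set.Iic s => poissonProcess r ω) ∈ B ↔ (ω, y) ∈ A := Set.ext_iff.1 hBA ω
      by_cases h : (ω, y) ∈ A <;> simp [h, this]
    simp only [e]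
    exact (integral_poisson_past_mul K hB hF y).symm
  · rw [jumpLaw, integral_prod _ (hbr.integrable _), integral_prod _ (hbmid.integrable _)]
    refine integral_congr_ae (.of_forall fun ω => ?_)
    obtain ⟨B, hB, hBA⟩ := exists_section_chain hA ω
    have e : ∀ y, A.indicator (fun _ => (1 : ℝ)) (ω, y) =
        B.indicator (fun _ => (1 : ℝ)) (frestrictLe (poissonProcess s ω) y) := fun y => by
      have : frestrictLe (poissonProcess s ω) y ∈ B ↔ (ω, y) ∈ A := Set.ext_iff.1 hBA y
      by_cases h : (ω, y) ∈ A <;> simp [h, this]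
    simp only [e, jumpProcess, poissonProcess_add]
    exact (integral_chainLaw_add K ν _ _ (isBoundedMeasurable_indicator hB) hF).symm

theorem isMarkovProcess_jumpProcess :
    IsMarkovProcess (jumpProcess (S := S)) (jumpLaw K ν) (jumpTransition K) where
  measurable := measurable_jumpProcess
  markov s t F hF := by
    have hs : Measurable[jumpPast S s] (jumpProcess (S := S) s) :=
      measurable_iff_comap_le.2 (le_iSup₂_of_le s le_rfl le_rfl)
    have hb := (hF.markovOp (jumpTransition K t)).comp (measurable_jumpProcess s)
    refine (ae_eq_condExp_of_forall_setIntegral_eq (jumpPast_le s)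
      ((hF.comp (measurable_jumpProcess (s + t))).integrable _)
      (fun A _ _ => (hb.integrable _).integrableOn)
      (fun A hA _ => setIntegral_jumpProcess K ν hA hF) ?_).symm
    exact (((hF.markovOp (jumpTransition K t)).1.comp hs).stronglyMeasurable).aestronglyMeasurable

end JumpProcess

/-! ### Uniqueness of the law of a Markov process -/

section LawUniqueness

variable {S : Type*} [MeasurableSpace S] {p : ℝ≥0 → Kernel S S} {W : Type*} [MeasurableSpace W]
  {X : ℝ≥0 → W → S} {μ : Measure W}

theorem map_real_pi (hX : Measurable fun ω t => X t ω) (I : Finset ℝ≥0) {B : ℝ≥0 → Set S}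
    (hB : ∀ i, MeasurableSet (B i)) :
    (μ.map fun ω t => X t ω).real ((I : Set ℝ≥0).pi B) =
      ∫ ω, ∏ i ∈ I, (B i).indicator (fun _ => (1 : ℝ)) (X i ω) ∂μ := by
  classical
  have hC : MeasurableSet ((I : Set ℝ≥0).pi B) :=
    MeasurableSet.pi I.countable_toSet fun i _ => hB i
  rw [map_measureReal_apply hX hC, ← integral_indicator_one (hX hC)]
  refine integral_congr_ae (.of_forall fun ω => ?_)
  have hmem : ω ∈ (fun ω t => X t ω) ⁻¹' (I : Set ℝ≥0).pi B ↔ ∀ i ∈ I, X i ω ∈ B i := Iff.rfl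
  simp only [Set.indicator_apply, hmem, Finset.prod_ite_zero, Finset.prod_const_one, Pi.one_apply]

variable [IsProbabilityMeasure μ]

theorem isBoundedMeasurable_prod {ι : Type*} (I : Finset ι) {f : ι → W → ℝ}
    (hf : ∀ i ∈ I, IsBoundedMeasurable (f i)) : IsBoundedMeasurable fun ω => ∏ i ∈ I, f i ω := by
  classical
  induction I using Finset.induction_on with
  | empty => exact ⟨by simp, 1, by simp⟩
  | insert a I ha ih =>
    simp only [Finset.prod_insert ha]
    exact (hf a (Finset.mem_insert_self a I)).mul
      (ih fun i hi => hf i (Finset.mem_insert_of_mem hi))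

theorem IsMarkovProcess.integral_mul_add (h : IsMarkovProcess X μ p) (s t : ℝ≥0) {G : W → ℝ}
    (hG : IsBoundedMeasurable G)
    (hGm : Measurable[⨆ r ≤ s, MeasurableSpace.comap (X r) inferInstance] G) {F : S → ℝ}
    (hF : IsBoundedMeasurable F) :
    ∫ ω, G ω * F (X (s + t) ω) ∂μ = ∫ ω, G ω * markovOp (p t) F (X s ω) ∂μ := by
  have hm : ⨆ r ≤ s, MeasurableSpace.comap (X r) inferInstance ≤ ‹MeasurableSpace W› :=
    iSup₂_le fun r _ => (h.measurable r).comap_le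
  have hFX := hF.comp (h.measurable (s + t))
  rw [← integral_condExp hm]
  refine integral_congr_ae ?_
  refine (condExp_mul_of_stronglyMeasurable_left hGm.stronglyMeasurable
    ((hG.mul hFX).integrable μ) (hFX.integrable μ)).trans ?_
  filter_upwards [h.markov s t F hF] with ω hω
  rw [Pi.mul_apply, hω]
  rfl

/-- Conditioning on the past of `s` absorbs the factor at the last time `a` into the factor at `s`;
one time fewer remains, with modified test functions. -/
theorem IsMarkovProcess.integral_prod_insert (h : IsMarkovProcess X μ p)
    {I : Finset ℝ≥0} {s a : ℝ≥0} (hs : s ∈ I) (hmax : ∀ i ∈ I, i ≤ s) (ha : s < a)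
    {f : ℝ≥0 → S → ℝ} (hf : ∀ i, IsBoundedMeasurable (f i)) :
    ∫ ω, ∏ i ∈ insert a I, f i (X i ω) ∂μ =
      ∫ ω, ∏ i ∈ I, Function.update f s (fun x => f s x * markovOp (p (a - s)) (f a) x) i (X i ω)
        ∂μ := by
  have haI : a ∉ I := fun hi => (hmax a hi).not_gt ha
  have hGm : Measurable[⨆ r ≤ s, MeasurableSpace.comap (X r) inferInstance]
      fun ω => ∏ i ∈ I, f i (X i ω) :=
    Finset.measurable_fun_prod _ fun i hi => (hf i).1.comp
      (measurable_iff_comap_le.2 (le_iSup₂_of_le i (hmax i hi) le_rfl))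
  have key := h.integral_mul_add s (a - s)
    (isBoundedMeasurable_prod I fun i _ => (hf i).comp (h.measurable i)) hGm (hf a)
  rw [add_tsub_cancel_of_le ha.le] at key
  simp only [Finset.prod_insert haI, mul_comm (f a _)]
  rw [key]
  refine integral_congr_ae (.of_forall fun ω => ?_)
  simp only
  rw [← Finset.mul_prod_erase I _ hs, ← Finset.mul_prod_erase I _ hs, Function.update_self,
    mul_right_comm]
  congr 1
  refine Finset.prod_congr rfl fun i hi => ?_
  rw [Function.update_of_ne (Finset.ne_of_mem_erase hi)]

theorem IsMarkovProcess.integral_prod_eq (hp : ∀ t, IsMarkovKernel (p t)) {W' : Type*}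
    [MeasurableSpace W'] {X' : ℝ≥0 → W' → S} {μ' : Measure W'} [IsProbabilityMeasure μ']
    (h : IsMarkovProcess X μ p) (h' : IsMarkovProcess X' μ' p)
    (h0 : μ.map (X 0) = μ'.map (X' 0)) (I : Finset ℝ≥0) {f : ℝ≥0 → S → ℝ}
    (hf : ∀ i, IsBoundedMeasurable (f i)) :
    ∫ ω, ∏ i ∈ I, f i (X i ω) ∂μ = ∫ ω, ∏ i ∈ I, f i (X' i ω) ∂μ' := by
  induction I using Finset.induction_on_max generalizing f with
  | empty => simp
  | insert a I hI ih =>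
    rcases I.eq_empty_or_nonempty with rfl | hne
    -- With a single time left, conditioning at time 0 with `G = 1` reduces to the initial law.
    · have hb := (hf a).markovOp (p a)
      have key := h.integral_mul_add 0 a (G := fun _ => 1) ⟨measurable_const, 1, by simp⟩
        measurable_const (hf a)
      have key' := h'.integral_mul_add 0 a (G := fun _ => 1) ⟨measurable_const, 1, by simp⟩
        measurable_const (hf a)
      simp only [one_mul, zero_add] at key key'
      simp only [insert_empty_eq, Finset.prod_singleton]
      rw [key, key', ← integral_map (h.measurable 0).aemeasurable hb.1.aestronglyMeasurable,
        ← integral_map (h'.measurable 0).aemeasurable hb.1.aestronglyMeasurable, h0]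
    · have hs := I.max'_mem hne
      have hmax : ∀ i ∈ I, i ≤ I.max' hne := fun i hi => I.le_max' i hi
      rw [h.integral_prod_insert hs hmax (hI _ hs) hf, h'.integral_prod_insert hs hmax (hI _ hs) hf]
      refine ih fun i => ?_
      rcases eq_or_ne i (I.max' hne) with rfl | hi
      · rw [Function.update_self]
        exact (hf _).mul ((hf a).markovOp _)
      · rw [Function.update_of_ne hi]
        exact hf i

/-- Square cylinders form a π-system generating the product σ-algebra, and products of indicators
compute their measures. -/
theorem IsMarkovProcess.map_eq (hp : ∀ t, IsMarkovKernel (p t)) {W' : Type*}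
    [MeasurableSpace W'] {X' : ℝ≥0 → W' → S} {μ' : Measure W'} [IsProbabilityMeasure μ']
    (h : IsMarkovProcess X μ p) (h' : IsMarkovProcess X' μ' p)
    (h0 : μ.map (X 0) = μ'.map (X' 0)) :
    μ.map (fun ω t => X t ω) = μ'.map (fun ω t => X' t ω) := by
  classical
  have hX : Measurable fun ω t => X t ω := measurable_pi_lambda _ h.measurable
  have hX' : Measurable fun ω t => X' t ω := measurable_pi_lambda _ h'.measurable
  have : IsProbabilityMeasure (μ.map fun ω t => X t ω) :=
    Measure.isProbabilityMeasure_map hX.aemeasurable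
  have : IsProbabilityMeasure (μ'.map fun ω t => X' t ω) :=
    Measure.isProbabilityMeasure_map hX'.aemeasurable
  refine ext_of_generate_finite _ generateFrom_squareCylinders.symm
    (isPiSystem_squareCylinders (fun _ => MeasurableSpace.isPiSystem_measurableSet)
      fun _ => MeasurableSet.univ) ?_ (by simp)
  rintro _ ⟨I, B, hB, rfl⟩
  have hB : ∀ i, MeasurableSet (B i) := fun i => hB i (Set.mem_univ i)
  rw [← measureReal_eq_measureReal_iff, map_real_pi hX I hB, map_real_pi hX' I hB]
  exact h.integral_prod_eq hp h' h0 I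
    (f := fun i => (B i).indicator fun _ => (1 : ℝ)) fun i => isBoundedMeasurable_indicator (hB i)

end LawUniqueness

/-! ### Measurability of the insertion of a point -/

namespace Configuration

variable {d : ℕ} {P : TopologicalSpace.Compacts (EuclideanSpace ℝ (Fin d))}

theorem dist_eq_tsum (η σ : Configuration P) :
    dist η σ = ∑' i : ℕ, (1 / 2 : ℝ) ^ (i + 1) * entryDist (η.entry i) (σ.entry i) :=
  rfl

theorem entry_add_zero (η : Configuration P) (y : P) : (η.add y).entry 0 = some y := by
  simp [entry, add]

theorem entry_add_succ (η : Configuration P) (y : P) (i : ℕ) :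
    (η.add y).entry (i + 1) = η.entry i := by
  by_cases h : i < η.size
  · have h' : i + 1 < η.size + 1 := Nat.succ_lt_succ h
    rw [entry, entry, dif_pos h, dif_pos (show i + 1 < (η.add y).size from h')]
    rfl
  · simp [entry, add, h]

/-- Prepending a point shifts every old entry by one place and so halves its weight. -/
theorem dist_add_add (η σ : Configuration P) (y z : P) :
    dist (η.add y) (σ.add z) = 1 / 2 * dist y z + 1 / 2 * dist η σ := by
  rw [dist_eq_tsum, (summable_entryDist _ _).tsum_eq_zero_add, dist_eq_tsum, ← tsum_mul_left]
  simp only [entry_add_zero, entry_add_succ]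
  congr 1
  · rw [Subtype.dist_eq, dist_eq_norm]
    simp [entryDist]
  · exact tsum_congr fun i => by ring

theorem continuous_add : Continuous fun z : Configuration P × P => z.1.add z.2 := by
  have : LipschitzWith 1 fun z : Configuration P × P => z.1.add z.2 := by
    refine LipschitzWith.of_dist_le_mul fun a b => ?_
    rw [dist_add_add, Prod.dist_eq, NNReal.coe_one, one_mul]
    have h1 := le_max_left (dist a.1 b.1) (dist a.2 b.2)
    have h2 := le_max_right (dist a.1 b.1) (dist a.2 b.2)
    linarith
  exact this.continuous

theorem continuous_mk (n : ℕ) : Continuous fun x : Fin n → P => (⟨n, x⟩ : Configuration P) := by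
  have : LipschitzWith 1 fun x : Fin n → P => (⟨n, x⟩ : Configuration P) := by
    refine LipschitzWith.of_dist_le_mul fun x y => ?_
    -- The weights sum to 1, so a bound by `dist x y` on every entry passes to the whole series.
    have hg : HasSum (fun i : ℕ => (1 / 2 : ℝ) ^ (i + 1) * dist x y) (dist x y) := by
      have := (hasSum_geometric_two' (dist x y))
      convert this using 2 with i
      rw [pow_succ, div_pow, one_pow]
      ring
    rw [NNReal.coe_one, one_mul, dist_eq_tsum, ← hg.tsum_eq]
    refine (summable_entryDist _ _).tsum_le_tsum (fun i => ?_) hg.summable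
    refine mul_le_mul_of_nonneg_left ?_ (by positivity)
    by_cases h : i < n
    · simp only [entry, h, dif_pos, entryDist]
      rw [← dist_eq_norm]
      exact dist_le_pi_dist x y ⟨i, h⟩
    · simp [entry, h, entryDist]
  exact this.continuous

/-- The space is a continuous image of the countable disjoint union of the powers of `P`, hence
separable, which suffices in a pseudometric space. -/
instance : SecondCountableTopology (Configuration P) := by
  have hc : Continuous fun z : (n : ℕ) × (Fin n → P) => (⟨z.1, z.2⟩ : Configuration P) :=
    continuous_sigma continuous_mk
  have hs : Function.Surjective
      fun z : (n : ℕ) × (Fin n → P) => (⟨z.1, z.2⟩ : Configuration P) :=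
    fun η => ⟨⟨η.size, η.point⟩, rfl⟩
  have : TopologicalSpace.SeparableSpace (Configuration P) := hs.denseRange.separableSpace hc
  exact UniformSpace.secondCountable_of_separable _

theorem measurable_add : Measurable fun z : Configuration P × P => z.1.add z.2 :=
  continuous_add.measurable

/-- The law of `η ⊕ y`, where `y` has law `λ(η, ·)`. -/
noncomputable def addKernel (lam : Kernel (Configuration P) P) :
    Kernel (Configuration P) (Configuration P) :=
  (Kernel.id ×ₖ lam).map fun z => z.1.add z.2

variable (lam : Kernel (Configuration P) P) [IsMarkovKernel lam]

instance : IsMarkovKernel (addKernel lam) :=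
  Kernel.IsMarkovKernel.map _ measurable_add

theorem markovOp_addKernel {F : Configuration P → ℝ} (hF : IsBoundedMeasurable F)
    (η : Configuration P) : markovOp (addKernel lam) F η = ∫ y, F (η.add y) ∂(lam η) := by
  rw [markovOp, addKernel, Kernel.map_apply _ measurable_add, Kernel.prod_apply, Kernel.id_apply,
    integral_map measurable_add.aemeasurable hF.1.aestronglyMeasurable, Measure.dirac_prod]
  exact integral_map measurable_prodMk_left.aemeasurable
    (hF.1.comp measurable_add).aestronglyMeasurable

theorem configurationGenerator_eq {F : Configuration P → ℝ} (hF : IsBoundedMeasurable F) :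
    configurationGenerator lam F = fun η => markovOp (addKernel lam) F η - F η := by
  funext η
  have h : IsBoundedMeasurable fun y => F (η.add y) :=
    hF.comp (measurable_add.comp measurable_prodMk_left)
  rw [configurationGenerator, integral_sub (h.integrable _) (integrable_const _),
    markovOp_addKernel lam hF]
  simp

end Configuration

/-! ### Transfer between operators that agree on bounded measurable functions -/

section Congr

variable {S : Type*} [MeasurableSpace S] {A B : (S → ℝ) → S → ℝ}

theorem IsBoundedOperator.congr (hA : IsBoundedOperator A)
    (h : ∀ F, IsBoundedMeasurable F → B F = A F) : IsBoundedOperator B where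
  maps F hF := by
    rw [h F hF]
    exact hA.maps F hF
  map_add F G hF hG := by
    rw [h F hF, h G hG, h (F + G) (hF.add hG), hA.map_add F G hF hG]
  map_smul c F hF := by
    have hc : IsBoundedMeasurable (c • F) :=
      IsBoundedMeasurable.mul ⟨measurable_const (a := c), |c|, fun _ => le_rfl⟩ hF
    rw [h F hF, h _ hc, hA.map_smul c F hF]
  bounded := hA.bounded.imp fun C hC F hF => by
    rw [h F hF]
    exact hC F hF

theorem HasGenerator.congr {p : ℝ≥0 → Kernel S S} (hp : HasGenerator p A)
    (h : ∀ F, IsBoundedMeasurable F → B F = A F) : HasGenerator p B := fun F hF => by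
  rw [h F hF]
  exact hp F hF

end Congr

theorem mainTheorem6 {d : ℕ}
    (P : TopologicalSpace.Compacts (EuclideanSpace ℝ (Fin d)))
    (lam : Kernel (Configuration P) P) [IsMarkovKernel lam] :
    IsBoundedOperator (configurationGenerator lam) ∧
    (∃! p : ℝ≥0 → Kernel (Configuration P) (Configuration P),
      IsTransitionFunction p ∧ HasGenerator p (configurationGenerator lam)) ∧
    ∀ (ν : Measure (Configuration P)) [IsProbabilityMeasure ν],
      (∃ (W : Type) (_ : MeasurableSpace W) (μ : Measure W) (_ : IsProbabilityMeasure μ)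
        (X : ℝ≥0 → W → Configuration P),
        IsMarkovProcessWithGenerator X μ (configurationGenerator lam) ∧ μ.map (X 0) = ν) ∧
      (∀ (W : Type*) [MeasurableSpace W] (μ : Measure W) [IsProbabilityMeasure μ]
        (X : ℝ≥0 → W → Configuration P)
        (W' : Type*) [MeasurableSpace W'] (μ' : Measure W') [IsProbabilityMeasure μ']
        (X' : ℝ≥0 → W' → Configuration P),
        IsMarkovProcessWithGenerator X μ (configurationGenerator lam) → μ.map (X 0) = ν →
        IsMarkovProcessWithGenerator X' μ' (configurationGenerator lam) → μ'.map (X' 0) = ν →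
        μ.map (fun ω t => X t ω) = μ'.map (fun ω t => X' t ω)) := by
  set K := Configuration.addKernel lam
  have hA : IsBoundedOperator (configurationGenerator lam) :=
    (isBoundedOperator_markovOp_sub K).congr fun F hF =>
      Configuration.configurationGenerator_eq lam hF
  have hp : IsTransitionFunction (jumpTransition K) := isTransitionFunction_jumpTransition K
  have hpA : HasGenerator (jumpTransition K) (configurationGenerator lam) :=
    (hasGenerator_jumpTransition K).congr fun F hF =>
      Configuration.configurationGenerator_eq lam hF
  refine ⟨hA, ⟨jumpTransition K, ⟨hp, hpA⟩, fun q hq =>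
    HasGenerator.transitionFunction_unique hA hq.1 hp hq.2 hpA⟩, fun ν _ => ⟨?_, ?_⟩⟩
  · exact ⟨_, inferInstance, jumpLaw K ν, inferInstance, jumpProcess,
      ⟨jumpTransition K, hp, hpA, isMarkovProcess_jumpProcess K ν⟩, map_jumpProcess_zero K ν⟩
  · rintro W _ μ _ X W' _ μ' _ X' ⟨p, h1, h2, h⟩ h0 ⟨p', h1', h2', h'⟩ h0'
    -- Each process comes with its own transition function; the common generator identifies them.
    obtain rfl := HasGenerator.transitionFunction_unique hA h1 h1' h2 h2'
    exact h.map_eq h1.markov h' (h0.trans h0'.symm)
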